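/- Let $\mathbb F$ be a field and $V$ a nonzero finite-dimensional vector space over $\mathbb F$. A tridiagonal pair on $V$ is an ordered pair of diagonalizable linear maps $A,A^*:V\to V$ such that the eigenspaces of $A$ can be ordered as $V_0,\dots,V_d$ with $A^*V_i\subseteq V_{i-1}+V_i+V_{i+1}$, the eigenspaces of $A^*$ can be ordered as $V^*_0,\dots,V^*_\delta$ with $AV^*_i\subseteq V^*_{i-1}+V^*_i+V^*_{i+1}$ (where $V_{-1}=V_{d+1}=V^*_{-1}=V^*_{\delta+1}=0$), and no subspace other than $0$ and $V$ is invariant under both maps; such orderings are called standard. A tridiagonal system of diameter $d$ is a sequence $\Phi=(A;\{E_i\}_{i=0}^d;A^*;\{E^*_i\}_{i=0}^d)$, where $A,A^*$ is a tridiagonal pair and $\{E_i\}$, $\{E^*_i\}$ are the primitive idempotents of $A$, $A^*$, in orders for which $\{E_iV\}$, $\{E^*_iV\}$ are standard orderings of the eigenspaces. Let $\theta_i$, $\theta^*_i$ be the eigenvalues of $A$, $A^*$ on $E_iV$, $E^*_iV$. Call $\Phi$ sharp if $\dim E_0V=1$. Put $$\Phi^*=(A^*;\{E^*_i\};A;\{E_i\}),\quad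 \Phi^{\downarrow}=(A;\{E_i\};A^*;\{E^*_{d-i}\}),\quad \Phi^{\Downarrow}=(A;\{E_{d-i}\};A^*;\{E^*_i\});$$ these three involutions generate an action of the dihedral group $D_4$, and the relatives of $\Phi$ are the members of its orbit. A base of $\Phi$ is a scalar $\beta\in\mathbb F$ such that, if $d\ge 3$, $\beta+1$ is the common value of $\frac{\theta_{i-2}-\theta_{i+1}}{\theta_{i-1}-\theta_i}$ and $\frac{\theta^*_{i-2}-\theta^*_{i+1}}{\theta^*_{i-1}-\theta^*_i}$ for $2\le i\le d-1$; if $d\le 2$, any nonzero $\beta$ is allowed. The type is I if $\beta\ne\pm2$; IV if $\operatorname{char}\mathbb F=2$ and $\beta=0$; and, if $\operatorname{char}\mathbb F\neq 2$, II if $\beta=2$, III$^+$ if $\beta=-2$ and $d$ is even, III$^-$ if $\beta=-2$ and $d$ is odd. For $0\le i\le d$ let $\zeta_i$ be the eigenvalue on $U_0=E^*_0V\cap(E_0V+\cdots+E_dV)=E^*_0V$ of $$(A^*-\theta^*_1I)\cdots(A^*-\theta^*_iI)(A-\theta_{i-1}I)\cdots(A-\theta_0I).$$ The Drinfel'd polynomial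 $P\in\mathbb F[\lambda]$ of $\Phi$ (for the base $\beta$) is as follows. If the type is not III$^+$, then $$P=\sum_{i=0}^d\zeta_i\,p_{i+1}p_{i+2}\cdots p_d,\qquad p_i=(\theta_0\theta^*_d+\theta_d\theta^*_0-\lambda)\alpha_i+(\theta_0-\theta_i)(\theta^*_0-\theta^*_i),$$ where $\alpha_i=\frac{(q^i-q^{-i})^2}{(q^d-q^{-d})^2}$ with $q^2+q^{-2}=\beta$ for type I (this lies in $\mathbb F$), $\alpha_i=i^2/d^2$ for type II, and, for types III$^-$ and IV, $\alpha_i=0$ if $i$ is even and $\alpha_i=1$ if $i$ is odd. If the type is III$^+$, then $P=p_1p_2\cdots p_d$, where $p_i=(\theta_0\theta^*_d+\theta_d\theta^*_0-\lambda)i^2/d^2+(\theta_0-\theta_i)(\theta^*_0-\theta^*_i)$ for even $i$ and $p_i=\theta_0\theta^*_d+\theta_d\theta^*_0-\lambda$ for odd $i$. **Theorem.** Let $\Phi$ be a sharp tridiagonal system. Then a base of $\Phi$ exists; every relative of $\Phi$ is sharp, and its scalars $\zeta_i$ exist and are unique. For every base $\beta$ of $\Phi$, each relative $\Psi$ of $\Phi$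 also has base $\beta$, and the Drinfel'd polynomials of $\Psi$ and $\Phi$ for the base $\beta$ are equal. In other words, $P$ is $D_4$-invariant; in particular it is unchanged under $\Phi\mapsto\Phi^*$, $\Phi^{\downarrow}$, $\Phi^{\Downarrow}$. Consequently $P$ is an invariant of the tridiagonal pair: if $\Psi$ is any tridiagonal system on $V$ whose associated tridiagonal pair is $A,A^*$ or $A^*,A$, then $\Psi$ has diameter $d$, is sharp, has base $\beta$, and has the same Drinfel'd polynomial as $\Phi$ for the base $\beta$. -/

import Mathlib

open Polynomial

/-! ### Tridiagonal pairs -/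

/-- `W` is an eigenspace of `A`: a nonzero subspace `{v | A v = t v}` for some scalar `t`. -/
def IsEigenspace {F V : Type*} [Field F] [AddCommGroup V] [Module F V]
    (A : Module.End F V) (W : Submodule F V) : Prop :=
  W ≠ ⊥ ∧ ∃ t : F, W = A.eigenspace t

/-- `A` is diagonalizable: `V` is spanned by the eigenspaces of `A`. -/
def IsDiagonalizableEnd {F V : Type*} [Field F] [AddCommGroup V] [Module F V]
    (A : Module.End F V) : Prop :=
  sSup {W : Submodule F V | IsEigenspace A W} = ⊤

/-- `W 0, …, W d` is an ordering of the eigenspaces of `A` (each occurs exactly once). -/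
def IsEigenspaceOrdering {F V : Type*} [Field F] [AddCommGroup V] [Module F V] {d : ℕ}
    (A : Module.End F V) (W : Fin (d + 1) → Submodule F V) : Prop :=
  Function.Injective W ∧ ∀ U : Submodule F V, IsEigenspace A U ↔ ∃ i, W i = U

/-- `W 0, …, W d` is a standard ordering of the eigenspaces of `A`, relative to `B`:
`B (W i) ⊆ W (i-1) + W i + W (i+1)`, where `W (-1) = W (d+1) = 0`. -/
def IsStandardOrdering {F V : Type*} [Field F] [AddCommGroup V] [Module F V] {d : ℕ}
    (A B : Module.End F V) (W : Fin (d + 1) → Submodule F V) : Prop :=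
  IsEigenspaceOrdering A W ∧
    ∀ i : Fin (d + 1), (W i).map B ≤
      ⨆ j : {j : Fin (d + 1) // (j : ℕ) ≤ (i : ℕ) + 1 ∧ (i : ℕ) ≤ (j : ℕ) + 1}, W j

/-- `A, B` is a tridiagonal pair on `V` (`B` plays the role of `A*`). -/
structure IsTridiagonalPair {F V : Type*} [Field F] [AddCommGroup V] [Module F V]
    (A B : Module.End F V) : Prop where
  diag : IsDiagonalizableEnd A
  diag_star : IsDiagonalizableEnd B
  ordering : ∃ (d : ℕ) (W : Fin (d + 1) → Submodule F V), IsStandardOrdering A B W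
  ordering_star : ∃ (δ : ℕ) (W : Fin (δ + 1) → Submodule F V), IsStandardOrdering B A W
  irreducible : ∀ W : Submodule F V, W.map A ≤ W → W.map B ≤ W → W = ⊥ ∨ W = ⊤

/-! ### Tridiagonal systems -/

/-- `E 0, …, E d` is a standard ordering of the primitive idempotents of `A`, relative to `B`:
the spaces `E i V` form a standard ordering of the eigenspaces of `A`, and `E i` is the
identity on `E i V` and zero on `E j V` for `j ≠ i`. -/
structure IsStandardIdempotents {F V : Type*} [Field F] [AddCommGroup V] [Module F V] {d : ℕ}
    (A B : Module.End F V) (E : Fin (d + 1) → Module.End F V) : Prop where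
  standard : IsStandardOrdering A B (fun i => LinearMap.range (E i))
  apply_self : ∀ i, ∀ v ∈ LinearMap.range (E i), E i v = v
  apply_of_ne : ∀ i j, j ≠ i → ∀ v ∈ LinearMap.range (E j), E i v = 0

theorem IsStandardIdempotents.rev {F V : Type*} [Field F] [AddCommGroup V] [Module F V] {d : ℕ}
    {A B : Module.End F V} {E : Fin (d + 1) → Module.End F V}
    (h : IsStandardIdempotents A B E) :
    IsStandardIdempotents A B (fun i => E (Fin.rev i)) where
  standard := by
    obtain ⟨⟨hinj, hall⟩, htri⟩ := h.standard
    refine ⟨⟨fun i j hij => Fin.rev_injective (hinj hij), fun U => (hall U).trans ?_⟩,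
      fun i => (htri (Fin.rev i)).trans (iSup_le ?_)⟩
    · constructor
      · rintro ⟨i, hi⟩
        exact ⟨Fin.rev i, by simpa using hi⟩
      · rintro ⟨i, hi⟩
        exact ⟨Fin.rev i, hi⟩
    · rintro ⟨j, hj⟩
      have hj' : ((Fin.rev j : Fin (d + 1)) : ℕ) ≤ (i : ℕ) + 1 ∧
          (i : ℕ) ≤ ((Fin.rev j : Fin (d + 1)) : ℕ) + 1 := by
        have := i.isLt
        have := j.isLt
        simp only [Fin.val_rev] at hj ⊢
        omega
      refine le_trans ?_ (le_iSup (fun k : {k : Fin (d + 1) //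
        (k : ℕ) ≤ (i : ℕ) + 1 ∧ (i : ℕ) ≤ (k : ℕ) + 1} =>
          LinearMap.range (E (Fin.rev (k : Fin (d + 1))))) ⟨Fin.rev j, hj'⟩)
      simp
  apply_self i := h.apply_self (Fin.rev i)
  apply_of_ne i j hij := h.apply_of_ne _ _ (fun e => hij (Fin.rev_injective e))

theorem IsTridiagonalPair.symm {F V : Type*} [Field F] [AddCommGroup V] [Module F V]
    {A B : Module.End F V} (h : IsTridiagonalPair A B) : IsTridiagonalPair B A :=
  ⟨h.diag_star, h.diag, h.ordering_star, h.ordering, fun W hB hA => h.irreducible W hA hB⟩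

/-- A tridiagonal system `(A; {E i}; A*; {E* i})` on `V`, of diameter `d`. -/
structure TridiagonalSystem (F V : Type*) [Field F] [AddCommGroup V] [Module F V] (d : ℕ) where
  A : Module.End F V
  E : Fin (d + 1) → Module.End F V
  Astar : Module.End F V
  Estar : Fin (d + 1) → Module.End F V
  pair : IsTridiagonalPair A Astar
  standard : IsStandardIdempotents A Astar E
  standard_star : IsStandardIdempotents Astar A Estar

/-- The types of tridiagonal systems. -/
inductive TridiagonalType
  | I
  | II
  | IIIplus
  | IIIminus
  | IV

open Classical in
/-- The type attached to the diameter `d` and the base `β`. In the second case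
`β = 2 = -2 = 0`. -/
noncomputable def tridiagonalType {F : Type*} [Field F] (d : ℕ) (β : F) : TridiagonalType :=
  if β ≠ 2 ∧ β ≠ -2 then .I
  else if CharP F 2 then .IV
  else if β = 2 then .II
  else if Even d then .IIIplus
  else .IIIminus

/-- The polynomials `C n` satisfy `C n (x + x⁻¹) = x ^ n + x ^ (-n)`. Hence for
`β = q ^ 2 + q ^ (-2)` one has `C n (β) - 2 = (q ^ n - q ^ (-n)) ^ 2`. -/
theorem chebyshevC_eval_sub_two {K : Type*} [Field K] (q : K) (hq : q ≠ 0) (n : ℕ) :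
    (Chebyshev.C K n).eval (q ^ 2 + (q ^ 2)⁻¹) - 2 = (q ^ n - (q ^ n)⁻¹) ^ 2 := by
  have key : ∀ n : ℕ, (Chebyshev.C K n).eval (q ^ 2 + (q ^ 2)⁻¹) = (q ^ 2) ^ n + ((q ^ 2) ^ n)⁻¹ ∧
      (Chebyshev.C K ((n : ℤ) + 1)).eval (q ^ 2 + (q ^ 2)⁻¹) =
        (q ^ 2) ^ (n + 1) + ((q ^ 2) ^ (n + 1))⁻¹ := by
    intro n
    induction n with
    | zero => norm_num
    | succ n ih =>
      refine ⟨by exact_mod_cast ih.2, ?_⟩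
      have e : (((n + 1 : ℕ) : ℤ) + 1) = (n : ℤ) + 2 := by push_cast; ring
      rw [e, Chebyshev.C_add_two, eval_sub, eval_mul, eval_X, ih.1, ih.2]
      field_simp
      ring
  rw [(key n).1]
  field_simp
  ring

/-- The scalars `α i` of the Drinfel'd polynomial (not used for type `III⁺`). For type `I`
this is `(q ^ i - q ^ (-i)) ^ 2 / (q ^ d - q ^ (-d)) ^ 2` with `q ^ 2 + q ^ (-2) = β`, written
as a rational function of `β`; see `drinfeldAlpha_typeI`. -/
noncomputable def drinfeldAlpha {F : Type*} [Field F] (d : ℕ) (β : F) (i : ℕ) : F :=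
  match tridiagonalType d β with
  | .I => ((Chebyshev.C F i).eval β - 2) / ((Chebyshev.C F d).eval β - 2)
  | .II => (i : F) ^ 2 / (d : F) ^ 2
  | _ => if Even i then 0 else 1

theorem drinfeldAlpha_typeI {F : Type*} [Field F] (d : ℕ) (β : F) (i : ℕ)
    (hβ : tridiagonalType d β = .I) (q : AlgebraicClosure F) (hq : q ≠ 0)
    (hqβ : q ^ 2 + (q ^ 2)⁻¹ = algebraMap F (AlgebraicClosure F) β) :
    algebraMap F (AlgebraicClosure F) (drinfeldAlpha d β i) =
      (q ^ i - (q ^ i)⁻¹) ^ 2 / (q ^ d - (q ^ d)⁻¹) ^ 2 := by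
  have hmap : ∀ n : ℕ, algebraMap F (AlgebraicClosure F) ((Chebyshev.C F n).eval β - 2) =
      (q ^ n - (q ^ n)⁻¹) ^ 2 := by
    intro n
    rw [← chebyshevC_eval_sub_two q hq n, hqβ, map_sub, map_ofNat,
      ← Chebyshev.map_C (algebraMap F (AlgebraicClosure F)), eval_map_algebraMap,
      aeval_algebraMap_apply, coe_aeval_eq_eval]
  unfold drinfeldAlpha
  rw [hβ]
  simp only [map_div₀, hmap]

namespace TridiagonalSystem

/-- `Φ* = (A*; {E* i}; A; {E i})`. -/
def star {F V : Type*} [Field F] [AddCommGroup V] [Module F V] {d : ℕ}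
    (Φ : TridiagonalSystem F V d) : TridiagonalSystem F V d where
  A := Φ.Astar
  E := Φ.Estar
  Astar := Φ.A
  Estar := Φ.E
  pair := Φ.pair.symm
  standard := Φ.standard_star
  standard_star := Φ.standard

/-- `Φ^↓ = (A; {E i}; A*; {E* (d-i)})`. -/
def down {F V : Type*} [Field F] [AddCommGroup V] [Module F V] {d : ℕ}
    (Φ : TridiagonalSystem F V d) : TridiagonalSystem F V d where
  A := Φ.A
  E := Φ.E
  Astar := Φ.Astar
  Estar := fun i => Φ.Estar (Fin.rev i)
  pair := Φ.pair
  standard := Φ.standard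
  standard_star := Φ.standard_star.rev

/-- `Φ^⇓ = (A; {E (d-i)}; A*; {E* i})`. -/
def ddown {F V : Type*} [Field F] [AddCommGroup V] [Module F V] {d : ℕ}
    (Φ : TridiagonalSystem F V d) : TridiagonalSystem F V d where
  A := Φ.A
  E := fun i => Φ.E (Fin.rev i)
  Astar := Φ.Astar
  Estar := Φ.Estar
  pair := Φ.pair
  standard := Φ.standard.rev
  standard_star := Φ.standard_star

/-- `Φ.Relative Ψ`: the system `Ψ` lies in the orbit of `Φ` under the action of the dihedral
group `D₄` generated by the involutions `*`, `↓`, `⇓`. -/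
inductive Relative {F V : Type*} [Field F] [AddCommGroup V] [Module F V] {d : ℕ}
    (Φ : TridiagonalSystem F V d) : TridiagonalSystem F V d → Prop
  | refl : Relative Φ Φ
  | star {Ψ : TridiagonalSystem F V d} : Relative Φ Ψ → Relative Φ Ψ.star
  | down {Ψ : TridiagonalSystem F V d} : Relative Φ Ψ → Relative Φ Ψ.down
  | ddown {Ψ : TridiagonalSystem F V d} : Relative Φ Ψ → Relative Φ Ψ.ddown

theorem exists_eigenvalue {F V : Type*} [Field F] [AddCommGroup V] [Module F V] {d : ℕ}
    (Φ : TridiagonalSystem F V d) (i : Fin (d + 1)) :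
    ∃ t : F, LinearMap.range (Φ.E i) = Φ.A.eigenspace t :=
  ((Φ.standard.standard.1.2 _).2 ⟨i, rfl⟩).2

/-- The eigenvalue `θ i` of `A` associated with the eigenspace `E i V`. -/
noncomputable def eigenvalue {F V : Type*} [Field F] [AddCommGroup V] [Module F V] {d : ℕ}
    (Φ : TridiagonalSystem F V d) (i : Fin (d + 1)) : F :=
  (Φ.exists_eigenvalue i).choose

theorem range_eq_eigenspace {F V : Type*} [Field F] [AddCommGroup V] [Module F V] {d : ℕ}
    (Φ : TridiagonalSystem F V d) (i : Fin (d + 1)) :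
    LinearMap.range (Φ.E i) = Φ.A.eigenspace (Φ.eigenvalue i) :=
  (Φ.exists_eigenvalue i).choose_spec

/-- The eigenvalue `θ* i` of `A*` associated with the eigenspace `E* i V`. -/
noncomputable def dualEigenvalue {F V : Type*} [Field F] [AddCommGroup V] [Module F V] {d : ℕ}
    (Φ : TridiagonalSystem F V d) (i : Fin (d + 1)) : F :=
  Φ.star.eigenvalue i

/-- `Φ` is sharp: the eigenspace `E 0 V` has dimension one. -/
def IsSharp {F V : Type*} [Field F] [AddCommGroup V] [Module F V] {d : ℕ}
    (Φ : TridiagonalSystem F V d) : Prop :=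
  Module.finrank F (LinearMap.range (Φ.E 0)) = 1

/-- `β` is a base of `Φ`. For `d ≥ 3`, `β + 1` is the common value of
`(θ (i-2) - θ (i+1)) / (θ (i-1) - θ i)` and `(θ* (i-2) - θ* (i+1)) / (θ* (i-1) - θ* i)` for
`2 ≤ i ≤ d - 1` (below `i - 2` is called `k`). For `d ≤ 2`, `β` is any nonzero scalar. -/
def IsBase {F V : Type*} [Field F] [AddCommGroup V] [Module F V] {d : ℕ}
    (Φ : TridiagonalSystem F V d) (β : F) : Prop :=
  (∀ (k : ℕ) (hk : k + 3 ≤ d),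
    (Φ.eigenvalue ⟨k, by omega⟩ - Φ.eigenvalue ⟨k + 3, by omega⟩) /
        (Φ.eigenvalue ⟨k + 1, by omega⟩ - Φ.eigenvalue ⟨k + 2, by omega⟩) = β + 1 ∧
    (Φ.dualEigenvalue ⟨k, by omega⟩ - Φ.dualEigenvalue ⟨k + 3, by omega⟩) /
        (Φ.dualEigenvalue ⟨k + 1, by omega⟩ - Φ.dualEigenvalue ⟨k + 2, by omega⟩) = β + 1) ∧
  (d ≤ 2 → β ≠ 0)

/-- The component `U i = (E* 0 V + ⋯ + E* i V) ∩ (E i V + ⋯ + E d V)` of the split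
decomposition. -/
def splitSpace {F V : Type*} [Field F] [AddCommGroup V] [Module F V] {d : ℕ}
    (Φ : TridiagonalSystem F V d) (i : Fin (d + 1)) : Submodule F V :=
  (⨆ j : Set.Iic i, LinearMap.range (Φ.Estar j)) ⊓ (⨆ j : Set.Ici i, LinearMap.range (Φ.E j))

/-- The linear map `(A* - θ* 1) ⋯ (A* - θ* i) (A - θ (i-1)) ⋯ (A - θ 0)`. -/
noncomputable def splitMap {F V : Type*} [Field F] [AddCommGroup V] [Module F V] {d : ℕ}
    (Φ : TridiagonalSystem F V d) (i : Fin (d + 1)) : Module.End F V :=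
  aeval Φ.Astar (∏ j ∈ Finset.Ioc 0 i, (X - C (Φ.dualEigenvalue j))) *
    aeval Φ.A (∏ j ∈ Finset.Iio i, (X - C (Φ.eigenvalue j)))

/-- `ζ` is the split sequence of `Φ`: for each `i` the space `U 0` is invariant under
`splitMap i`, with eigenvalue `ζ i`. -/
def IsSplitSequence {F V : Type*} [Field F] [AddCommGroup V] [Module F V] {d : ℕ}
    (Φ : TridiagonalSystem F V d) (ζ : Fin (d + 1) → F) : Prop :=
  ∀ i, ∀ u ∈ Φ.splitSpace 0, Φ.splitMap i u = ζ i • u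

/-- The split sequence of `Φ`. -/
noncomputable def splitSeq {F V : Type*} [Field F] [AddCommGroup V] [Module F V] {d : ℕ}
    (Φ : TridiagonalSystem F V d) : Fin (d + 1) → F :=
  Classical.epsilon Φ.IsSplitSequence

/-- The polynomial `p i` for all types other than `III⁺`. -/
noncomputable def drinfeldFactor {F V : Type*} [Field F] [AddCommGroup V] [Module F V] {d : ℕ}
    (Φ : TridiagonalSystem F V d) (β : F) (i : Fin (d + 1)) : F[X] :=
  (C (Φ.eigenvalue 0 * Φ.dualEigenvalue (Fin.last d) +
      Φ.eigenvalue (Fin.last d) * Φ.dualEigenvalue 0) - X) * C (drinfeldAlpha d β i) +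
    C ((Φ.eigenvalue 0 - Φ.eigenvalue i) * (Φ.dualEigenvalue 0 - Φ.dualEigenvalue i))

/-- The polynomial `p i` for type `III⁺`. -/
noncomputable def drinfeldFactorIIIplus {F V : Type*} [Field F] [AddCommGroup V] [Module F V]
    {d : ℕ} (Φ : TridiagonalSystem F V d) (i : Fin (d + 1)) : F[X] :=
  if Even (i : ℕ) then
    (C (Φ.eigenvalue 0 * Φ.dualEigenvalue (Fin.last d) +
        Φ.eigenvalue (Fin.last d) * Φ.dualEigenvalue 0) - X) *
        C (((i : ℕ) : F) ^ 2 / (d : F) ^ 2) +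
      C ((Φ.eigenvalue 0 - Φ.eigenvalue i) * (Φ.dualEigenvalue 0 - Φ.dualEigenvalue i))
  else
    C (Φ.eigenvalue 0 * Φ.dualEigenvalue (Fin.last d) +
      Φ.eigenvalue (Fin.last d) * Φ.dualEigenvalue 0) - X

/-- The Drinfel'd polynomial of `Φ` with base `β`: `p 1 ⋯ p d` for type `III⁺`, and
`∑ i, ζ i p (i+1) ⋯ p d` otherwise. -/
noncomputable def drinfeldPoly {F V : Type*} [Field F] [AddCommGroup V] [Module F V] {d : ℕ}
    (Φ : TridiagonalSystem F V d) (β : F) : F[X] :=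
  match tridiagonalType d β with
  | .IIIplus => ∏ i ∈ Finset.Ioi (0 : Fin (d + 1)), Φ.drinfeldFactorIIIplus i
  | _ => ∑ i : Fin (d + 1), C (Φ.splitSeq i) * ∏ j ∈ Finset.Ioi i, Φ.drinfeldFactor β j

end TridiagonalSystem

/-!
If `Φ` is sharp, then `E* 0` has rank one, so `E* 0 * E j * E* 0 = m j • E* 0` for scalars `m j`,
and by the shape of the split maps `ζ i = ∏ k < i, (θ* 0 - θ* (k + 1))` times
`∑ j, m j * ∏ k < i, (θ j - θ k)`. Hence, outside type `III⁺`, the Drinfel'd polynomial is, up to a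
constant factor, `∑ j, m j * G (θ j)` with an explicit sum `G`. Passing to `Φ^⇓` reverses the
sequences `m` and `θ`, so it suffices that each value `G (θ j)` is unchanged when the sequence `θ`
is reversed. The eigenvalue sequences and the numerators of `α` all satisfy the linear recurrence
with parameter `β`. For generic `β` they are combinations of `1`, `w ^ n` and `w ^ (-n)`, a
Saalschütz-type summation writes `G (θ j)` as a product, and reversing `θ` permutes its factors;
the general case follows since both sides are polynomials in `β`. In type `III⁺` the factors
`p (2k + 1)` and `p (2k + 2)` multiply to a constant times
`(θ 0 θ* d + θ d θ* 0 - X) (θ 0 θ* 0 + θ d θ* d - X)`.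

Invariance under `*` holds because `ζ i` is the same for `Φ` and `Φ*`: for both it is the scalar
`c` with `E 0 (A* - θ* 0) ⋯ (A* - θ* (i-1)) (A - θ (i-1)) ⋯ (A - θ 0) E* 0 = c E 0 E* 0`, as this
product does not change when the first `i` factors are replaced by those with `θ* 1, …, θ* i`, or
the last `i` factors by those with `θ 1, …, θ i`. The operation `↓` is `⇓` conjugated by `*`.
Finally, `E (i + 1) A* E i ≠ 0` while `E i A* E j = 0` for `|i - j| > 1`, so two standard orderings
differ by a permutation that moves neighbours to neighbours: the identity or the reversal.
-/

/-! ### Recurrent sequences -/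

section BetaRecurrent

variable {R S : Type*} [CommRing R] [CommRing S]

/-- The `β`-recurrent sequence with initial values `a`, `b`, `c`. For a sequence of distinct
scalars `s`, the recurrence says that `(s n - s (n + 3)) / (s (n + 1) - s (n + 2)) = β + 1`. -/
def betaRecurrent (β a b c : R) : ℕ → R
  | 0 => a
  | 1 => b
  | 2 => c
  | n + 3 => betaRecurrent β a b c n -
      (β + 1) * (betaRecurrent β a b c (n + 1) - betaRecurrent β a b c (n + 2))

theorem map_betaRecurrent (f : R →+* S) (β a b c : R) (n : ℕ) :
    f (betaRecurrent β a b c n) = betaRecurrent (f β) (f a) (f b) (f c) n := by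
  induction n using betaRecurrent.induct with
  | case1 | case2 | case3 => simp [betaRecurrent]
  | case4 n h₁ h₂ h₃ => simp [betaRecurrent, h₁, h₂, h₃]

theorem eq_betaRecurrent {β : R} {s : ℕ → R} {d : ℕ}
    (hs : ∀ k, k + 3 ≤ d → s k - s (k + 3) = (β + 1) * (s (k + 1) - s (k + 2)))
    (n : ℕ) (hn : n ≤ d) : s n = betaRecurrent β (s 0) (s 1) (s 2) n := by
  induction n using betaRecurrent.induct with
  | case1 | case2 | case3 => simp [betaRecurrent]
  | case4 n h₁ h₂ h₃ =>
    rw [betaRecurrent, ← h₁ (by omega), ← h₂ (by omega), ← h₃ (by omega), ← hs n hn]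
    ring

end BetaRecurrent

section ClosedForm

variable {K : Type*} [Field K] {w : K}

theorem add_mul_pow_add_mul_inv_pow_eq_betaRecurrent (hw : w ≠ 0) (a b c : K) (n : ℕ) :
    a + b * w ^ n + c * (w ^ n)⁻¹ = betaRecurrent (w + w⁻¹) (a + b + c) (a + b * w + c * w⁻¹)
      (a + b * w ^ 2 + c * (w ^ 2)⁻¹) n := by
  have hrec : ∀ k, k + 3 ≤ n → (a + b * w ^ k + c * (w ^ k)⁻¹) -
      (a + b * w ^ (k + 3) + c * (w ^ (k + 3))⁻¹) = (w + w⁻¹ + 1) *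
      ((a + b * w ^ (k + 1) + c * (w ^ (k + 1))⁻¹) -
        (a + b * w ^ (k + 2) + c * (w ^ (k + 2))⁻¹)) := fun k _ => by
    field_simp
    ring
  simpa using eq_betaRecurrent (s := fun n => a + b * w ^ n + c * (w ^ n)⁻¹) hrec n le_rfl

theorem exists_betaRecurrent_eq (hw : w ≠ 0) (h₁ : w ≠ 1) (h₂ : w ≠ -1) (x y z : K) :
    ∃ a b c : K, ∀ n,
      betaRecurrent (w + w⁻¹) x y z n = a + b * w ^ n + c * (w ^ n)⁻¹ := by
  have h₁' : w - 1 ≠ 0 := sub_ne_zero.2 h₁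
  have h₂' : w + 1 ≠ 0 := fun h => h₂ (eq_neg_of_add_eq_zero_left h)
  let b := (w * (z - y) - (y - x)) / ((w - 1) ^ 2 * (w + 1))
  let c := w ^ 2 * (z - y - w * (y - x)) / ((w - 1) ^ 2 * (w + 1))
  refine ⟨x - b - c, b, c, fun n => ?_⟩
  rw [add_mul_pow_add_mul_inv_pow_eq_betaRecurrent hw]
  have hx : x - b - c + b + c = x := by ring
  have hy : x - b - c + b * w + c * w⁻¹ = y := by simp only [b, c]; field_simp; ring
  have hz : x - b - c + b * w ^ 2 + c * (w ^ 2)⁻¹ = z := by simp only [b, c]; field_simp; ring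
  rw [hx, hy, hz]

theorem betaRecurrent_zero_one (hw : w ≠ 0) (h₁ : w ≠ 1) (n : ℕ) :
    betaRecurrent (w + w⁻¹) 0 1 (w + w⁻¹ + 2) n =
      w / (w - 1) ^ 2 * ((1 - w ^ n) ^ 2 / w ^ n) := by
  have h₁' : w - 1 ≠ 0 := sub_ne_zero.2 h₁
  let κ := w / (w - 1) ^ 2
  have h := add_mul_pow_add_mul_inv_pow_eq_betaRecurrent hw (-2 * κ) κ κ n
  have hy : -2 * κ + κ * w + κ * w⁻¹ = 1 := by simp only [κ]; field_simp; ring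
  have hz : -2 * κ + κ * w ^ 2 + κ * (w ^ 2)⁻¹ = w + w⁻¹ + 2 := by
    simp only [κ]; field_simp; ring
  rw [show -2 * κ + κ + κ = 0 by ring, hy, hz] at h
  rw [← h]
  change _ = κ * _
  field_simp
  ring

theorem exists_add_inv_eq [IsAlgClosed K] (β : K) : ∃ w : K, w ≠ 0 ∧ w + w⁻¹ = β := by
  have hdeg : (X ^ 2 - C β * X + 1 : K[X]).degree = 2 := by compute_degree!
  obtain ⟨w, hw⟩ := IsAlgClosed.exists_root _ (hdeg.trans_ne two_ne_zero)
  have hroot : w ^ 2 - β * w + 1 = 0 := by simpa [IsRoot] using hw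
  have hw₀ : w ≠ 0 := by rintro rfl; simp at hroot
  refine ⟨w, hw₀, ?_⟩
  field_simp
  linear_combination hroot

theorem ne_one_and_ne_neg_one_of_add_inv_ne (h₁ : w + w⁻¹ ≠ 2) (h₂ : w + w⁻¹ ≠ -2) :
    w ≠ 1 ∧ w ≠ -1 := by
  constructor
  · rintro rfl
    exact h₁ (by norm_num)
  · rintro rfl
    exact h₂ (by norm_num)

end ClosedForm

section Summation

open Finset

variable {R : Type*} [CommRing R]

/-- The `i`-th summand of the left side of the `q`-Saalschütz type summation
`sum_saalschutzTerm`, where only `θ`, `φ` and `j` vary in the induction. -/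
def saalschutzTerm (h ν θ φ : ℕ → R) (j i : ℕ) : R :=
  (∏ k ∈ range i, (θ j - θ k) * h k) * ∏ k ∈ Ico i j, ν (k + 1) * φ (k + 1)

theorem saalschutzTerm_of_lt (h ν θ φ : ℕ → R) {j i : ℕ} (hji : j < i) :
    saalschutzTerm h ν θ φ j i = 0 := by
  rw [saalschutzTerm, prod_eq_zero (mem_range.2 hji) (by rw [sub_self, zero_mul]), zero_mul]

theorem saalschutzTerm_succ_zero (h ν θ φ : ℕ → R) (j : ℕ) :
    saalschutzTerm h ν θ φ (j + 1) 0 = ν (j + 1) *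
      (φ 1 * saalschutzTerm h ν (fun n => θ (n + 1)) (fun n => φ (n + 1)) j 0) := by
  simp only [saalschutzTerm, range_zero, prod_empty, Nat.Ico_zero_eq_range, prod_mul_distrib,
    prod_range_succ (fun k => ν (k + 1)), prod_range_succ' (fun k => φ (k + 1))]
  ring

/-- The analogue of Pascal's rule for binomial coefficients. -/
theorem saalschutzTerm_succ_succ {h ν θ φ : ℕ → R} {ψ : R}
    (hψ : ∀ k, ν (k + 1) * (φ (k + 1) - ψ) = (θ 0 - θ (k + 1)) * h k) {j i : ℕ} (hi : i ≤ j) :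
    saalschutzTerm h ν θ φ (j + 1) (i + 1) = ν (j + 1) *
      (φ (i + 2) * saalschutzTerm h ν (fun n => θ (n + 1)) (fun n => φ (n + 1)) j (i + 1) -
        (φ (i + 1) - ψ) *
          saalschutzTerm h ν (fun n => θ (n + 1)) (fun n => φ (n + 1)) j i) := by
  have hdiff : ∏ k ∈ range (i + 1), (θ (j + 1) - θ k) * h k =
      (∏ k ∈ range i, (θ (j + 1) - θ (k + 1)) * h k) * ((θ (j + 1) - θ 0) * h i) := by
    simp only [prod_mul_distrib, prod_range_succ' (fun k => θ (j + 1) - θ k), prod_range_succ h]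
    ring
  rcases hi.eq_or_lt with rfl | hlt
  · rw [saalschutzTerm_of_lt _ _ _ _ (Nat.lt_succ_self i), saalschutzTerm, saalschutzTerm, hdiff,
      Ico_self, Ico_self, prod_empty, prod_empty]
    linear_combination (∏ k ∈ range i, (θ (i + 1) - θ (k + 1)) * h k) * hψ i
  · have hshift : ∀ m, ∏ k ∈ Ico m j, φ (k + 2) = ∏ k ∈ Ico (m + 1) (j + 1), φ (k + 1) :=
      fun m => prod_Ico_add' (fun k => φ (k + 1)) m j 1
    have hφ : ∏ k ∈ Ico (i + 1) (j + 1), φ (k + 1) =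
        φ (i + 2) * ∏ k ∈ Ico (i + 2) (j + 1), φ (k + 1) :=
      prod_eq_prod_Ico_succ_bot (Nat.succ_lt_succ hlt) _
    have hν : ∏ k ∈ Ico i j, ν (k + 1) = ν (i + 1) * ∏ k ∈ Ico (i + 1) j, ν (k + 1) :=
      prod_eq_prod_Ico_succ_bot hlt _
    have hν' : ∏ k ∈ Ico (i + 1) (j + 1), ν (k + 1) =
        (∏ k ∈ Ico (i + 1) j, ν (k + 1)) * ν (j + 1) := prod_Ico_succ_top hlt _
    simp only [saalschutzTerm, hdiff, prod_range_succ, prod_mul_distrib (s := Ico _ _), hshift,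
      hφ, hν, hν']
    linear_combination ν (j + 1) * (∏ k ∈ range i, (θ (j + 1) - θ (k + 1)) * h k) *
      (∏ k ∈ Ico (i + 1) j, ν (k + 1)) * φ (i + 2) *
      (∏ k ∈ Ico (i + 2) (j + 1), φ (k + 1)) * hψ i

/-- A summation formula of `q`-Saalschütz type. -/
theorem sum_saalschutzTerm {h ν : ℕ → R} (θ φ ψ : ℕ → R)
    (hψ : ∀ m k, ν (k + 1) * (φ (m + k + 1) - ψ m) = (θ m - θ (m + k + 1)) * h k) (j : ℕ) :
    ∑ i ∈ range (j + 1), saalschutzTerm h ν θ φ j i = ∏ m ∈ range j, ν (m + 1) * ψ m := by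
  induction j generalizing θ φ ψ with
  | zero => simp [saalschutzTerm]
  | succ j ih =>
    let T : ℕ → R := saalschutzTerm h ν (fun n => θ (n + 1)) (fun n => φ (n + 1)) j
    have hshift : ∑ i ∈ range (j + 1), T i = ∏ m ∈ range j, ν (m + 1) * ψ (m + 1) :=
      ih _ _ (fun m => ψ (m + 1)) fun m k => by
        simpa only [add_right_comm] using hψ (m + 1) k
    have hpascal : ∀ i ∈ range (j + 1), saalschutzTerm h ν θ φ (j + 1) (i + 1) =
        ν (j + 1) * (φ (i + 2) * T (i + 1)) - ν (j + 1) * ((φ (i + 1) - ψ 0) * T i) :=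
      fun i hi => by
        rw [saalschutzTerm_succ_succ (by simpa using hψ 0) (mem_range_succ_iff.1 hi), mul_sub]
    have hlast : T (j + 1) = 0 := saalschutzTerm_of_lt _ _ _ _ (Nat.lt_succ_self j)
    calc ∑ i ∈ range (j + 2), saalschutzTerm h ν θ φ (j + 1) i
      _ = ∑ i ∈ range (j + 2), ν (j + 1) * (φ (i + 1) * T i) -
          ∑ i ∈ range (j + 1), ν (j + 1) * ((φ (i + 1) - ψ 0) * T i) := by
        rw [sum_range_succ', sum_congr rfl hpascal, sum_sub_distrib, saalschutzTerm_succ_zero,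
          sub_add_eq_add_sub, ← sum_range_succ' (fun i => ν (j + 1) * (φ (i + 1) * T i))]
      _ = ν (j + 1) * ψ 0 * ∑ i ∈ range (j + 1), T i := by
        rw [sum_range_succ, hlast, mul_zero, mul_zero, add_zero, ← sum_sub_distrib, mul_sum]
        exact sum_congr rfl fun i _ => by ring
      _ = ∏ m ∈ range (j + 1), ν (m + 1) * ψ m := by
        rw [hshift, prod_mul_distrib, prod_mul_distrib, prod_range_succ, prod_range_succ' ψ]
        ring

theorem sum_prod_sub_mul_prod_eq_prod {h ν θ φ ψ : ℕ → R}
    (hψ : ∀ m k, ν (k + 1) * (φ (m + k + 1) - ψ m) = (θ m - θ (m + k + 1)) * h k)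
    {j d : ℕ} (hj : j ≤ d) :
    ∑ i ∈ range (d + 1), (∏ k ∈ range i, (θ j - θ k) * h k) *
        ∏ k ∈ Ico i d, ν (k + 1) * φ (k + 1) =
      (∏ k ∈ range d, ν (k + 1)) * ((∏ m ∈ range j, ψ m) * ∏ k ∈ Ico j d, φ (k + 1)) := by
  have hvanish : ∀ i ∈ range (d + 1), i ∉ range (j + 1) →
      (∏ k ∈ range i, (θ j - θ k) * h k) * ∏ k ∈ Ico i d, ν (k + 1) * φ (k + 1) = 0 :=
    fun i _ hi => by
      have hji : j ∈ range i := by simpa [Nat.lt_succ_iff] using hi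
      rw [prod_eq_zero hji (by rw [sub_self, zero_mul]), zero_mul]
  have hfactor : ∀ i ∈ range (j + 1), (∏ k ∈ range i, (θ j - θ k) * h k) *
        ∏ k ∈ Ico i d, ν (k + 1) * φ (k + 1) =
      saalschutzTerm h ν θ φ j i * ∏ k ∈ Ico j d, ν (k + 1) * φ (k + 1) := fun i hi => by
    rw [saalschutzTerm, ← prod_Ico_consecutive _ (mem_range_succ_iff.1 hi) hj, mul_assoc]
  rw [← sum_subset (range_subset_range.2 (by omega)) hvanish, sum_congr rfl hfactor, ← sum_mul,
    sum_saalschutzTerm θ φ ψ hψ, ← prod_range_mul_prod_Ico _ hj, prod_mul_distrib,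
    prod_mul_distrib]
  ring

end Summation

section DrinfeldSum

open Finset

variable {R T K : Type*} [CommRing R] [CommRing T] [Field K]

/-- The sum defining the Drinfel'd polynomial, multiplied by `S d ^ d` to clear the denominators of
`α i = S i / S d`. The split sequence enters through the scalars
`ζ i = ∏ k < i, (x - θ k) (σ 0 - σ (k + 1))`, where the trace functional of `E* 0` applied to a
polynomial in `A` replaces the variable `x`. -/
def drinfeldSum (d : ℕ) (θ σ S : ℕ → R) (z x : R) : R :=
  ∑ i ∈ range (d + 1), (∏ k ∈ range i, (x - θ k)) *
    (∏ k ∈ range i, (S d * (σ 0 - σ (k + 1)))) *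
    ∏ k ∈ Ico i d, ((θ 0 * σ d + θ d * σ 0 - z) * S (k + 1) +
      S d * ((θ 0 - θ (k + 1)) * (σ 0 - σ (k + 1))))

theorem map_drinfeldSum (f : R →+* T) (d : ℕ) (θ σ S : ℕ → R) (z x : R) :
    f (drinfeldSum d θ σ S z x) =
      drinfeldSum d (fun k => f (θ k)) (fun k => f (σ k)) (fun k => f (S k)) (f z) (f x) := by
  simp [drinfeldSum, map_sum, map_prod]

theorem drinfeldSum_congr {d : ℕ} {θ θ' σ σ' S S' : ℕ → R} {z x : R}
    (hθ : ∀ k ≤ d, θ k = θ' k) (hσ : ∀ k ≤ d, σ k = σ' k) (hS : ∀ k ≤ d, S k = S' k) :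
    drinfeldSum d θ σ S z x = drinfeldSum d θ' σ' S' z x := by
  refine sum_congr rfl fun i hi => ?_
  have hid : i ≤ d := mem_range_succ_iff.1 hi
  congr! 1
  · congr! 1
    · refine prod_congr rfl fun k hk => ?_
      rw [hθ k (by grind)]
    · refine prod_congr rfl fun k hk => ?_
      rw [hS d le_rfl, hσ 0 (by omega), hσ (k + 1) (by grind)]
  · refine prod_congr rfl fun k hk => ?_
    have hkd : k + 1 ≤ d := (mem_Ico.1 hk).2
    rw [hθ 0 (by omega), hθ d le_rfl, hθ _ hkd, hσ 0 (by omega), hσ d le_rfl, hσ _ hkd,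
      hS d le_rfl, hS _ hkd]

theorem drinfeldSum_eq_prod {d : ℕ} {θ σ S φ ψ : ℕ → R} {z : R}
    (hφ : ∀ k, (θ 0 * σ d + θ d * σ 0 - z) * S (k + 1) +
      S d * ((θ 0 - θ (k + 1)) * (σ 0 - σ (k + 1))) = S (k + 1) * φ (k + 1))
    (hψ : ∀ m k, S (k + 1) * (φ (m + k + 1) - ψ m) =
      (θ m - θ (m + k + 1)) * (S d * (σ 0 - σ (k + 1))))
    {j : ℕ} (hj : j ≤ d) :
    drinfeldSum d θ σ S z (θ j) =
      (∏ k ∈ range d, S (k + 1)) * ((∏ m ∈ range j, ψ m) * ∏ k ∈ Ico j d, φ (k + 1)) := by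
  simp only [drinfeldSum, hφ, ← prod_mul_distrib, sum_prod_sub_mul_prod_eq_prod hψ hj]

theorem drinfeldSum_eq_prod_of_closedForm {w : K} (hw : w ≠ 0) {d : ℕ} {θ σ S : ℕ → K}
    {a b c a' b' c' κ : K} (z : K) (hθ : ∀ n, θ n = a + b * w ^ n + c * (w ^ n)⁻¹)
    (hσ : ∀ n, σ n = a' + b' * w ^ n + c' * (w ^ n)⁻¹)
    (hS : ∀ n, S n = κ * ((1 - w ^ n) ^ 2 / w ^ n)) {j : ℕ} (hj : j ≤ d) :
    drinfeldSum d θ σ S z (θ j) = (∏ k ∈ range d, S (k + 1)) *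
      ((∏ m ∈ range j, (θ 0 * σ d + θ d * σ 0 - z + (1 - w ^ d) ^ 2 / w ^ d *
          (b * c' * w ^ m + c * b' * (w ^ m)⁻¹ - (b * c' + c * b')))) *
        ∏ k ∈ Ico j d, (θ 0 * σ d + θ d * σ 0 - z + (1 - w ^ d) ^ 2 / w ^ d *
          (b * b' * w ^ (k + 1) + c * c' * (w ^ (k + 1))⁻¹ - (b * c' + c * b')))) := by
  refine drinfeldSum_eq_prod (ψ := fun m => θ 0 * σ d + θ d * σ 0 - z + (1 - w ^ d) ^ 2 / w ^ d *
      (b * c' * w ^ m + c * b' * (w ^ m)⁻¹ - (b * c' + c * b')))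
    (φ := fun k => θ 0 * σ d + θ d * σ 0 - z + (1 - w ^ d) ^ 2 / w ^ d *
      (b * b' * w ^ k + c * c' * (w ^ k)⁻¹ - (b * c' + c * b'))) (fun k => ?_) (fun m k => ?_) hj
  · rw [mul_comm, mul_add (S _)]
    congr 1
    simp only [hθ, hσ, hS]
    field_simp
    ring
  · simp only [hθ, hσ, hS]
    field_simp
    ring

theorem drinfeldSum_reverse_of_closedForm {w : K} (hw : w ≠ 0) {d : ℕ} {θ σ S : ℕ → K}
    {a b c a' b' c' κ : K} (z : K) (hθ : ∀ n, θ n = a + b * w ^ n + c * (w ^ n)⁻¹)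
    (hσ : ∀ n, σ n = a' + b' * w ^ n + c' * (w ^ n)⁻¹)
    (hS : ∀ n, S n = κ * ((1 - w ^ n) ^ 2 / w ^ n)) {j : ℕ} (hj : j ≤ d) :
    drinfeldSum d (fun k => θ (d - k)) σ S z (θ j) = drinfeldSum d θ σ S z (θ j) := by
  let θ' : ℕ → K := fun n => a + c * (w ^ d)⁻¹ * w ^ n + b * w ^ d * (w ^ n)⁻¹
  have hθ' : ∀ k ≤ d, θ (d - k) = θ' k := fun k hk => by
    have hk' : w ^ d = w ^ (d - k) * w ^ k := by rw [← pow_add, Nat.sub_add_cancel hk]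
    simp only [hθ, θ', hk']
    field_simp
    ring
  have hθj : θ j = θ' (d - j) := by rw [← hθ' _ (d.sub_le j), Nat.sub_sub_self hj]
  have hω : θ' 0 * σ d + θ' d * σ 0 = θ 0 * σ d + θ d * σ 0 + (1 - w ^ d) ^ 2 / w ^ d *
      (b * b' * w ^ d + c * c' * (w ^ d)⁻¹ - (b * c' + c * b')) := by
    simp only [← hθ' 0 d.zero_le, ← hθ' d le_rfl, Nat.sub_zero, Nat.sub_self, hθ, hσ]
    field_simp
    ring
  rw [drinfeldSum_congr (S' := S) hθ' (fun _ _ => rfl) (fun _ _ => rfl), hθj,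
    drinfeldSum_eq_prod_of_closedForm hw z (fun _ => rfl) hσ hS (d.sub_le j), ← hθj,
    drinfeldSum_eq_prod_of_closedForm hw z hθ hσ hS hj, hω, mul_comm (∏ m ∈ range (d - j), _)]
  congr 2
  · refine prod_nbij' (fun k => d - 1 - k) (fun k => d - 1 - k) (by grind) (by grind) (by grind)
      (by grind) fun k hk => ?_
    have hk' : w ^ d = w ^ (d - 1 - k) * w ^ (k + 1) := by rw [← pow_add]; congr 1; grind
    rw [hk']
    field_simp
    ring
  · refine prod_nbij' (fun k => d - 1 - k) (fun k => d - 1 - k) (by grind) (by grind) (by grind)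
      (by grind) fun k hk => ?_
    have hk' : w ^ d = w ^ (d - 1 - k + 1) * w ^ k := by rw [← pow_add]; congr 1; grind
    rw [hk']
    field_simp
    ring

theorem drinfeldSum_betaRecurrent_reverse_of_ne [IsAlgClosed K] {β : K} (h₂ : β ≠ 2)
    (h₂' : β ≠ -2) (t₀ t₁ t₂ u₀ u₁ u₂ z : K) {d j : ℕ} (hj : j ≤ d) :
    drinfeldSum d (fun k => betaRecurrent β t₀ t₁ t₂ (d - k)) (betaRecurrent β u₀ u₁ u₂)
        (betaRecurrent β 0 1 (β + 2)) z (betaRecurrent β t₀ t₁ t₂ j) =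
      drinfeldSum d (betaRecurrent β t₀ t₁ t₂) (betaRecurrent β u₀ u₁ u₂)
        (betaRecurrent β 0 1 (β + 2)) z (betaRecurrent β t₀ t₁ t₂ j) := by
  obtain ⟨w, hw, rfl⟩ := exists_add_inv_eq β
  obtain ⟨hw₁, hw₂⟩ := ne_one_and_ne_neg_one_of_add_inv_ne h₂ h₂'
  obtain ⟨a, b, c, hθ⟩ := exists_betaRecurrent_eq hw hw₁ hw₂ t₀ t₁ t₂
  obtain ⟨a', b', c', hσ⟩ := exists_betaRecurrent_eq hw hw₁ hw₂ u₀ u₁ u₂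
  exact drinfeldSum_reverse_of_closedForm hw z hθ hσ (betaRecurrent_zero_one hw hw₁) hj

/-- Both sides are polynomials in `β`, so the generic case, in which `β`-recurrent sequences have a
closed form, suffices. -/
theorem drinfeldSum_betaRecurrent_reverse_of_isAlgClosed [IsAlgClosed K]
    (β t₀ t₁ t₂ u₀ u₁ u₂ z : K) {d j : ℕ} (hj : j ≤ d) :
    drinfeldSum d (fun k => betaRecurrent β t₀ t₁ t₂ (d - k)) (betaRecurrent β u₀ u₁ u₂)
        (betaRecurrent β 0 1 (β + 2)) z (betaRecurrent β t₀ t₁ t₂ j) =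
      drinfeldSum d (betaRecurrent β t₀ t₁ t₂) (betaRecurrent β u₀ u₁ u₂)
        (betaRecurrent β 0 1 (β + 2)) z (betaRecurrent β t₀ t₁ t₂ j) := by
  let θ : ℕ → K[X] := betaRecurrent X (C t₀) (C t₁) (C t₂)
  let σ : ℕ → K[X] := betaRecurrent X (C u₀) (C u₁) (C u₂)
  let S : ℕ → K[X] := betaRecurrent X 0 1 (X + 2)
  have hθ : ∀ y k, evalRingHom y (θ k) = betaRecurrent y t₀ t₁ t₂ k := fun y k => by
    simp [θ, map_betaRecurrent]
  have hσ : ∀ y k, evalRingHom y (σ k) = betaRecurrent y u₀ u₁ u₂ k := fun y k => by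
    simp [σ, map_betaRecurrent]
  have hS : ∀ y k, evalRingHom y (S k) = betaRecurrent y 0 1 (y + 2) k := fun y k => by
    simp [S, map_betaRecurrent]
  have hz : ∀ y, evalRingHom y (C z) = z := fun y => eval_C
  have hpoly : drinfeldSum d (fun k => θ (d - k)) σ S (C z) (θ j) =
      drinfeldSum d θ σ S (C z) (θ j) := by
    refine eq_of_infinite_eval_eq _ _
      (((Set.toFinite {(2 : K), -2}).infinite_compl).mono fun y hy => ?_)
    obtain ⟨hy₂, hy₂'⟩ : y ≠ 2 ∧ y ≠ -2 := by simpa using hy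
    have := drinfeldSum_betaRecurrent_reverse_of_ne hy₂ hy₂' t₀ t₁ t₂ u₀ u₁ u₂ z hj
    change evalRingHom y _ = evalRingHom y _
    simpa only [map_drinfeldSum, hθ, hσ, hS, hz] using this
  simpa only [map_drinfeldSum, hθ, hσ, hS, hz] using congrArg (evalRingHom β) hpoly

theorem drinfeldSum_betaRecurrent_reverse [IsDomain R] (β t₀ t₁ t₂ u₀ u₁ u₂ z : R) {d j : ℕ}
    (hj : j ≤ d) :
    drinfeldSum d (fun k => betaRecurrent β t₀ t₁ t₂ (d - k)) (betaRecurrent β u₀ u₁ u₂)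
        (betaRecurrent β 0 1 (β + 2)) z (betaRecurrent β t₀ t₁ t₂ j) =
      drinfeldSum d (betaRecurrent β t₀ t₁ t₂) (betaRecurrent β u₀ u₁ u₂)
        (betaRecurrent β 0 1 (β + 2)) z (betaRecurrent β t₀ t₁ t₂ j) := by
  let L := AlgebraicClosure (FractionRing R)
  let ι : R →+* L := (algebraMap (FractionRing R) L).comp (algebraMap R (FractionRing R))
  have hι : Function.Injective ι :=
    (algebraMap (FractionRing R) L).injective.comp (IsFractionRing.injective R (FractionRing R))
  apply hι
  simpa only [map_drinfeldSum, map_betaRecurrent, map_zero, map_one, map_add, map_ofNat] using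
    drinfeldSum_betaRecurrent_reverse_of_isAlgClosed (ι β) (ι t₀) (ι t₁) (ι t₂) (ι u₀) (ι u₁)
      (ι u₂) (ι z) hj

end DrinfeldSum

section DrinfeldAlpha

variable {F : Type*} [Field F]

theorem chebyshevC_eval_sub_two_eq (β : F) (n : ℕ) :
    (Chebyshev.C F n).eval β - 2 = (β - 2) * betaRecurrent β 0 1 (β + 2) n := by
  have hC : ∀ m : ℕ, (Chebyshev.C F (m + 2 : ℕ)).eval β =
      β * (Chebyshev.C F (m + 1 : ℕ)).eval β - (Chebyshev.C F m).eval β := fun m => by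
    push_cast
    rw [Chebyshev.C_add_two, eval_sub, eval_mul, eval_X]
  induction n using betaRecurrent.induct with
  | case1 | case2 => simp [betaRecurrent]
  | case3 =>
    rw [hC 0, betaRecurrent]
    simp only [Nat.cast_zero, zero_add, Nat.cast_one, Chebyshev.C_one, Chebyshev.C_zero, eval_X,
      eval_ofNat]
    ring
  | case4 n h₀ h₁ h₂ =>
    rw [betaRecurrent]
    linear_combination hC (n + 1) - hC n + h₀ - (β + 1) * (h₁ - h₂)

theorem betaRecurrent_two_zero_one (n : ℕ) : betaRecurrent (2 : F) 0 1 (2 + 2) n = n ^ 2 := by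
  have h := eq_betaRecurrent (β := (2 : F)) (s := fun n => (n : F) ^ 2) (d := n)
    (fun k _ => by push_cast; ring) n le_rfl
  rw [h]
  norm_num

theorem betaRecurrent_neg_two_zero_one (n : ℕ) :
    betaRecurrent (-2 : F) 0 1 (-2 + 2) n = if Even n then 0 else 1 := by
  have h := eq_betaRecurrent (β := (-2 : F)) (s := fun n => if Even n then 0 else 1) (d := n)
    (fun k _ => by by_cases hk : Even k <;> simp [hk, parity_simps] <;> norm_num) n le_rfl
  rw [h]
  norm_num

theorem betaRecurrent_two_eq (h₂ : (2 : F) ≠ 0) (a b c : F) (n : ℕ) :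
    betaRecurrent (2 : F) a b c n = a + n * (b - a) + n * (n - 1) / 2 * (c - 2 * b + a) := by
  have h := eq_betaRecurrent (β := (2 : F)) (d := n)
    (s := fun n => a + n * (b - a) + n * (n - 1) / 2 * (c - 2 * b + a))
    (fun k _ => by push_cast; field_simp; ring) n le_rfl
  rw [h]
  congr 1
  · norm_num
  · norm_num
  · field_simp
    ring

theorem betaRecurrent_neg_two_two_mul (a b c : F) (m : ℕ) :
    betaRecurrent (-2 : F) a b c (2 * m) = a + m * (c - a) := by
  have hstep : ∀ n, betaRecurrent (-2 : F) a b c (n + 4) =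
      2 * betaRecurrent (-2 : F) a b c (n + 2) - betaRecurrent (-2 : F) a b c n := fun n => by
    simp only [betaRecurrent]
    ring
  induction m using Nat.twoStepInduction with
  | zero | one => simp [betaRecurrent]
  | more m h₀ h₁ =>
    rw [mul_add, hstep, h₀, ← mul_add_one, h₁]
    push_cast
    ring

theorem betaRecurrent_zero_one_ne_zero {β : F} (h₂ : β ≠ 2) (h₂' : β ≠ -2) {a b c : F} {n : ℕ}
    (hn : betaRecurrent β a b c n ≠ betaRecurrent β a b c 0) :
    betaRecurrent β 0 1 (β + 2) n ≠ 0 := by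
  let ι := algebraMap F (AlgebraicClosure F)
  obtain ⟨w, hw, hwβ⟩ := exists_add_inv_eq (ι β)
  obtain ⟨hw₁, hw₂⟩ : w ≠ 1 ∧ w ≠ -1 := by
    refine ne_one_and_ne_neg_one_of_add_inv_ne ?_ ?_ <;> rw [hwβ] <;>
      simpa only [← map_ofNat ι, ← map_neg, ι.injective.ne_iff]
  obtain ⟨x, y, z, hclosed⟩ := exists_betaRecurrent_eq hw hw₁ hw₂ (ι a) (ι b) (ι c)
  have hwn : w ^ n ≠ 1 := fun h => hn <| ι.injective <| by
    rw [map_betaRecurrent, map_betaRecurrent, ← hwβ, hclosed, hclosed, h, pow_zero]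
  have hS : ι (betaRecurrent β 0 1 (β + 2) n) = w / (w - 1) ^ 2 * ((1 - w ^ n) ^ 2 / w ^ n) := by
    rw [map_betaRecurrent, map_zero, map_one, map_add, map_ofNat, ← hwβ,
      betaRecurrent_zero_one hw hw₁]
  rw [← ι.injective.ne_iff, map_zero, hS]
  have := sub_ne_zero.2 hw₁
  have := sub_ne_zero.2 hwn.symm
  positivity

theorem tridiagonalType_cases (d : ℕ) (β : F) :
    (tridiagonalType d β = .I ∧ β ≠ 2 ∧ β ≠ -2) ∨
    (tridiagonalType d β = .II ∧ β = 2 ∧ (2 : F) ≠ 0) ∨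
    (tridiagonalType d β = .IIIplus ∧ β = -2 ∧ (2 : F) ≠ 0 ∧ Even d) ∨
    (tridiagonalType d β = .IIIminus ∧ β = -2 ∧ ¬ Even d) ∨
    (tridiagonalType d β = .IV ∧ β = -2 ∧ (2 : F) = 0) := by
  have hchar : CharP F 2 ↔ (2 : F) = 0 :=
    ⟨fun _ => CharTwo.two_eq_zero, CharTwo.of_one_ne_zero_of_two_eq_zero one_ne_zero⟩
  rw [tridiagonalType, hchar]
  split_ifs with h₁ h₂ h₃ h₄
  · simp [h₁]
  · have hβ : β = -2 := by grind
    simp [h₂, hβ]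
  · simp [h₂, h₃]
  · have hβ : β = -2 := by grind
    simp [h₂, hβ, h₄]
  · have hβ : β = -2 := by grind
    simp [hβ, h₄]

theorem tridiagonalType_eq_IIIplus {d : ℕ} {β : F} (h : tridiagonalType d β = .IIIplus) :
    β = -2 ∧ (2 : F) ≠ 0 ∧ Even d := by
  rcases tridiagonalType_cases d β with
    ⟨h', -⟩ | ⟨h', -⟩ | ⟨-, hβ⟩ | ⟨h', -⟩ | ⟨h', -⟩
  case inr.inr.inl => exact hβ
  all_goals exact absurd (h.symm.trans h') TridiagonalType.noConfusion

theorem not_even_of_two_eq_zero {d : ℕ} {a b c : F} (h₂ : (2 : F) = 0)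
    (hs : Set.InjOn (betaRecurrent (-2 : F) a b c) (Set.Iic d)) (hd : 0 < d)
    (hβ : d ≤ 2 → (-2 : F) ≠ 0) : ¬ Even d := by
  intro heven
  have hd₂ : ¬ d ≤ 2 := fun hle => hβ hle (by rw [h₂, neg_zero])
  have hd₄ : 4 ≤ d := by grind
  have hrep : betaRecurrent (-2 : F) a b c 4 = betaRecurrent (-2 : F) a b c 0 := by
    rw [show 4 = 2 * 2 from rfl, betaRecurrent_neg_two_two_mul, Nat.cast_two, h₂, betaRecurrent]
    ring
  exact absurd (hs (Set.mem_Iic.2 hd₄) (Set.mem_Iic.2 hd.le) hrep) (by norm_num)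

theorem drinfeldAlpha_eq_betaRecurrent_div {d : ℕ} {β a b c : F}
    (hs : Set.InjOn (betaRecurrent β a b c) (Set.Iic d)) (hd : 0 < d) (hβ : d ≤ 2 → β ≠ 0)
    (htype : tridiagonalType d β ≠ .IIIplus) :
    betaRecurrent β 0 1 (β + 2) d ≠ 0 ∧ ∀ i, drinfeldAlpha d β i =
      betaRecurrent β 0 1 (β + 2) i / betaRecurrent β 0 1 (β + 2) d := by
  have hne : betaRecurrent β a b c d ≠ betaRecurrent β a b c 0 :=
    hs.ne Set.self_mem_Iic (Set.mem_Iic.2 hd.le) hd.ne'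
  have hodd : ¬ Even d → β = -2 → (∀ i, drinfeldAlpha d β i = if Even i then 0 else 1) →
      betaRecurrent β 0 1 (β + 2) d ≠ 0 ∧ ∀ i, drinfeldAlpha d β i =
        betaRecurrent β 0 1 (β + 2) i / betaRecurrent β 0 1 (β + 2) d := by
    rintro hd' rfl hα
    simp only [betaRecurrent_neg_two_zero_one, hα, if_neg hd', div_one]
    exact ⟨one_ne_zero, fun _ => trivial⟩
  rcases tridiagonalType_cases d β with
    ⟨htype', h₂, h₂'⟩ | ⟨htype', rfl, h₂⟩ | ⟨htype', -⟩ | ⟨htype', hβ₂, hd'⟩ | ⟨htype', rfl, h₂⟩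
  · refine ⟨betaRecurrent_zero_one_ne_zero h₂ h₂' hne, fun i => ?_⟩
    simp only [drinfeldAlpha, htype', chebyshevC_eval_sub_two_eq,
      mul_div_mul_left _ _ (sub_ne_zero.2 h₂)]
  · have hd₀ : (d : F) ≠ 0 := fun h => hne (by simp [betaRecurrent_two_eq h₂, h])
    simp only [drinfeldAlpha, htype', betaRecurrent_two_zero_one]
    exact ⟨pow_ne_zero 2 hd₀, fun _ => trivial⟩
  · exact absurd htype' htype
  · exact hodd hd' hβ₂ fun i => by simp only [drinfeldAlpha, htype']
  · exact hodd (not_even_of_two_eq_zero h₂ hs hd hβ) rfl fun i => by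
      simp only [drinfeldAlpha, htype']

theorem betaRecurrent_neg_two_sub {d : ℕ} (hd : Even d) (h₂ : (2 : F) ≠ 0) {a b c : F}
    (hs : betaRecurrent (-2 : F) a b c 0 ≠ betaRecurrent (-2 : F) a b c d) :
    (d : F) ≠ 0 ∧ ∀ i, Even i →
      betaRecurrent (-2 : F) a b c 0 - betaRecurrent (-2 : F) a b c i =
        (i : F) / d * (betaRecurrent (-2 : F) a b c 0 - betaRecurrent (-2 : F) a b c d) := by
  obtain ⟨m, rfl⟩ := even_iff_exists_two_mul.1 hd
  have hm : (m : F) ≠ 0 := fun hm => hs (by simp [betaRecurrent_neg_two_two_mul, hm, betaRecurrent])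
  refine ⟨by push_cast; exact mul_ne_zero h₂ hm, fun i hi => ?_⟩
  obtain ⟨k, rfl⟩ := even_iff_exists_two_mul.1 hi
  rw [betaRecurrent_neg_two_two_mul, betaRecurrent_neg_two_two_mul, betaRecurrent]
  push_cast
  field_simp
  ring

end DrinfeldAlpha

/-! ### Systems of idempotents -/

/-- `E 0, …, E d` is a standard ordering of the primitive idempotents of the diagonalizable map
`A` relative to `B`, with eigenvalues `θ 0, …, θ d`. So that neighbouring indices need no bound
checks, the indices are natural numbers and `E k = 0` for `k > d`. -/
structure IsIdempotentSystem {F V : Type*} [Field F] [AddCommGroup V] [Module F V]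
    (A B : Module.End F V) (d : ℕ) (E : ℕ → Module.End F V) (θ : ℕ → F) : Prop where
  sum_eq : ∑ k ∈ Finset.range (d + 1), E k = 1
  mul_self : ∀ k, E k * E k = E k
  mul_of_ne : ∀ i j, i ≠ j → E i * E j = 0
  left_mul : ∀ k, A * E k = θ k • E k
  mul_left : ∀ k, E k * A = θ k • E k
  ne_zero : ∀ k ≤ d, E k ≠ 0
  eq_zero : ∀ k, d < k → E k = 0
  injOn : Set.InjOn θ (Set.Iic d)
  tri : ∀ i j, i + 1 < j ∨ j + 1 < i → E i * B * E j = 0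

namespace IsIdempotentSystem

open Finset

variable {F V : Type*} [Field F] [AddCommGroup V] [Module F V]
  {A B Y Z : Module.End F V} {d : ℕ} {E : ℕ → Module.End F V} {θ : ℕ → F}

theorem sum_apply (h : IsIdempotentSystem A B d E θ) (v : V) :
    ∑ k ∈ range (d + 1), E k v = v := by
  rw [← LinearMap.sum_apply, h.sum_eq, Module.End.one_apply]

theorem mul_eq_sum (h : IsIdempotentSystem A B d E θ) (Y Z : Module.End F V) :
    Y * Z = ∑ k ∈ range (d + 1), Y * E k * Z := by
  rw [← sum_mul, ← mul_sum, h.sum_eq, mul_one]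

theorem ext (h : IsIdempotentSystem A B d E θ) (hYZ : ∀ i j, E i * Y * E j = E i * Z * E j) :
    Y = Z := by
  have hsum : ∀ Y : Module.End F V,
      Y = ∑ i ∈ range (d + 1), ∑ j ∈ range (d + 1), E i * Y * E j := fun Y => by
    simp only [← mul_sum, ← sum_mul, h.sum_eq, one_mul, mul_one]
  rw [hsum Y, hsum Z]
  simp only [hYZ]

theorem apply_self_apply (h : IsIdempotentSystem A B d E θ) (k : ℕ) (v : V) :
    E k (E k v) = E k v := by
  rw [← Module.End.mul_apply, h.mul_self]

theorem apply_apply_of_ne (h : IsIdempotentSystem A B d E θ) {i j : ℕ} (hij : i ≠ j) (v : V) :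
    E i (E j v) = 0 := by
  rw [← Module.End.mul_apply, h.mul_of_ne i j hij, LinearMap.zero_apply]

theorem apply_zero_eq_self (h : IsIdempotentSystem A B d E θ) {v : V}
    (hv : ∀ k, 0 < k → E k v = 0) : E 0 v = v := by
  conv_rhs => rw [← h.sum_apply v]
  exact (sum_eq_single_of_mem 0 (mem_range.2 d.succ_pos) fun k _ hk =>
    hv k (Nat.pos_of_ne_zero hk)).symm

theorem apply_sub_smul (h : IsIdempotentSystem A B d E θ) (k : ℕ) (c : F) (v : V) :
    E k (A v - c • v) = (θ k - c) • E k v := by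
  rw [map_sub, ← Module.End.mul_apply, h.mul_left, LinearMap.smul_apply, map_smul, sub_smul]

theorem apply_dual_sub_smul_eq_zero (h : IsIdempotentSystem A B d E θ) {k : ℕ} (c : F) {v : V}
    (hv : ∀ j, j ≤ k + 1 → k ≤ j + 1 → E j v = 0) : E k (B v - c • v) = 0 := by
  have hB : E k (B v) = 0 := by
    rw [← h.sum_apply v, map_sum, map_sum]
    refine sum_eq_zero fun j _ => ?_
    by_cases hj : j ≤ k + 1 ∧ k ≤ j + 1
    · rw [hv j hj.1 hj.2, map_zero, map_zero]
    · rw [← Module.End.mul_apply, ← Module.End.mul_apply, h.tri k j (by omega),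
        LinearMap.zero_apply]
  rw [map_sub, hB, map_smul, hv k (by omega) (by omega), smul_zero, sub_zero]

theorem aeval_mul (h : IsIdempotentSystem A B d E θ) (p : F[X]) (k : ℕ) :
    aeval A p * E k = p.eval (θ k) • E k := by
  have hpow : ∀ n, A ^ n * E k = θ k ^ n • E k := fun n => by
    induction n with
    | zero => simp
    | succ n ih => rw [pow_succ, mul_assoc, h.left_mul, mul_smul_comm, ih, smul_smul, pow_succ']
  rw [aeval_eq_sum_range, sum_mul, eval_eq_sum_range, sum_smul]
  simp only [smul_mul_assoc, hpow, smul_smul]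

theorem aeval_eq_sum (h : IsIdempotentSystem A B d E θ) (p : F[X]) :
    aeval A p = ∑ k ∈ range (d + 1), p.eval (θ k) • E k := by
  rw [← mul_one (aeval A p), ← h.sum_eq, mul_sum]
  exact sum_congr rfl fun k _ => h.aeval_mul p k

theorem mul_aeval (h : IsIdempotentSystem A B d E θ) (p : F[X]) (k : ℕ) :
    E k * aeval A p = p.eval (θ k) • E k := by
  by_cases hk : d < k
  · rw [h.eq_zero k hk, zero_mul, smul_zero]
  rw [h.aeval_eq_sum, mul_sum, sum_eq_single_of_mem k (mem_range_succ_iff.2 (not_lt.1 hk)),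
    mul_smul_comm, h.mul_self]
  intro j _ hj
  rw [mul_smul_comm, h.mul_of_ne k j hj.symm, smul_zero]

theorem mul_aeval_mul_aeval_mul (h : IsIdempotentSystem A B d E θ) (p q : F[X])
    (Y : Module.End F V) (i j : ℕ) : E i * (aeval A p * Y * aeval A q) * E j =
      (p.eval (θ i) * q.eval (θ j)) • (E i * Y * E j) := by
  rw [mul_assoc (E i), mul_assoc _ (aeval A q), h.aeval_mul, mul_smul_comm, mul_smul_comm,
    mul_assoc (aeval A p), ← mul_assoc (E i), h.mul_aeval, smul_mul_assoc, smul_smul, mul_comm,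
    mul_assoc]

theorem mul_pow_mul_eq_zero (h : IsIdempotentSystem A B d E θ) {n i j : ℕ}
    (hij : i + n < j ∨ j + n < i) : E i * B ^ n * E j = 0 := by
  induction n generalizing i with
  | zero => rw [pow_zero, mul_one, h.mul_of_ne i j (by omega)]
  | succ n ih =>
    rw [pow_succ', ← mul_assoc, mul_assoc, h.mul_eq_sum (E i * B)]
    refine sum_eq_zero fun k _ => ?_
    by_cases hk : i + 1 < k ∨ k + 1 < i
    · rw [h.tri i k hk, zero_mul]
    · rw [mul_assoc, ← mul_assoc (E k), ih (by omega), mul_zero]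

theorem mul_aeval_dual_mul_eq_zero (h : IsIdempotentSystem A B d E θ) {p : F[X]} {n i j : ℕ}
    (hp : p.degree < n) (hij : i + n ≤ j ∨ j + n ≤ i) : E i * aeval B p * E j = 0 := by
  rw [aeval_eq_sum_range, mul_sum, sum_mul]
  refine sum_eq_zero fun k _ => ?_
  rw [mul_smul_comm, smul_mul_assoc]
  by_cases hkn : k < n
  · rw [h.mul_pow_mul_eq_zero (by omega), smul_zero]
  · rw [coeff_eq_zero_of_degree_lt (hp.trans_le (Nat.cast_le.2 (not_lt.1 hkn))), zero_smul]

theorem mul_aeval_dual_mul_eq_coeff_smul (h : IsIdempotentSystem A B d E θ) {p : F[X]} {n : ℕ}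
    (hp : p.natDegree ≤ n) (i : ℕ) :
    E (i + n) * aeval B p * E i = p.coeff n • (E (i + n) * B ^ n * E i) := by
  rw [aeval_eq_sum_range' (Nat.lt_succ_of_le hp), mul_sum, sum_mul,
    sum_eq_single_of_mem n (self_mem_range_succ n), mul_smul_comm, smul_mul_assoc]
  intro k hk hkn
  rw [mul_smul_comm, smul_mul_assoc, h.mul_pow_mul_eq_zero (by grind), smul_zero]

theorem mul_pow_mul_self_mul_pow_mul_eq_zero (h : IsIdempotentSystem A B d E θ) {m n i j k : ℕ}
    (hk : k + m < j ∨ i + n < k) : E j * B ^ m * E k * (B ^ n * E i) = 0 := by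
  rcases hk with hk | hk
  · rw [h.mul_pow_mul_eq_zero (by omega), zero_mul]
  · rw [mul_assoc (E j * B ^ m), ← mul_assoc (E k), h.mul_pow_mul_eq_zero (by omega), mul_zero]

theorem mul_pow_mul_aeval_mul_pow_mul (h : IsIdempotentSystem A B d E θ) (p : F[X])
    (m n i j : ℕ) : E j * (B ^ m * aeval A p * B ^ n) * E i =
      ∑ k ∈ range (d + 1), p.eval (θ k) • (E j * B ^ m * E k * (B ^ n * E i)) := by
  rw [h.aeval_eq_sum]
  simp only [mul_sum, sum_mul, mul_smul_comm, smul_mul_assoc, mul_assoc]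

theorem mul_pow_mul_aeval_mul_pow_mul_eq_zero (h : IsIdempotentSystem A B d E θ) (p : F[X])
    {m n i j : ℕ} (hij : i + n + m < j) : E j * (B ^ m * aeval A p * B ^ n) * E i = 0 := by
  rw [h.mul_pow_mul_aeval_mul_pow_mul]
  refine sum_eq_zero fun k _ => ?_
  rw [h.mul_pow_mul_self_mul_pow_mul_eq_zero (by omega), smul_zero]

theorem mul_pow_mul_aeval_mul_pow_mul_eq_smul (h : IsIdempotentSystem A B d E θ) (p : F[X])
    {m n i : ℕ} (hd : i + n ≤ d) : E (i + n + m) * (B ^ m * aeval A p * B ^ n) * E i =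
      p.eval (θ (i + n)) • (E (i + n + m) * B ^ m * E (i + n) * (B ^ n * E i)) := by
  rw [h.mul_pow_mul_aeval_mul_pow_mul, sum_eq_single_of_mem _ (mem_range_succ_iff.2 hd)]
  intro k _ hk
  rw [h.mul_pow_mul_self_mul_pow_mul_eq_zero (by omega), smul_zero]

theorem mul_pow_add_mul (h : IsIdempotentSystem A B d E θ) {m n i : ℕ} (hd : i + n ≤ d) :
    E (i + n + m) * B ^ (m + n) * E i = E (i + n + m) * B ^ m * E (i + n) * (B ^ n * E i) := by
  have hone := h.mul_pow_mul_aeval_mul_pow_mul_eq_smul (m := m) 1 hd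
  rwa [map_one, mul_one, ← pow_add, eval_one, one_smul] at hone

theorem mul_pow_mul_left_mul_pow_mul (h : IsIdempotentSystem A B d E θ) {m n i : ℕ}
    (hd : i + n ≤ d) : E (i + n + m) * (B ^ m * A * B ^ n) * E i =
      θ (i + n) • (E (i + n + m) * B ^ (m + n) * E i) := by
  have hX := h.mul_pow_mul_aeval_mul_pow_mul_eq_smul (m := m) X hd
  rwa [aeval_X, eval_X, ← h.mul_pow_add_mul hd] at hX

end IsIdempotentSystem

/-- The space `(E* 0 V + ⋯ + E* i V) ∩ (E (i + r) V + ⋯ + E d V)`. For `r = 0` these are the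
components of the split decomposition; for `r = 1` they vanish. -/
def flagSpace {F V : Type*} [Field F] [AddCommGroup V] [Module F V]
    (E Es : ℕ → Module.End F V) (r i : ℕ) : Submodule F V :=
  (⨅ k ∈ Set.Ioi i, LinearMap.ker (Es k)) ⊓ ⨅ k ∈ Set.Iio (i + r), LinearMap.ker (E k)

theorem mem_flagSpace {F V : Type*} [Field F] [AddCommGroup V] [Module F V]
    {E Es : ℕ → Module.End F V} {r i : ℕ} {v : V} :
    v ∈ flagSpace E Es r i ↔ (∀ k, i < k → Es k v = 0) ∧ ∀ k < i + r, E k v = 0 := by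
  simp [flagSpace, Submodule.mem_iInf]

/-- A tridiagonal system whose idempotents and eigenvalues are indexed by the natural numbers:
`A, B` is a tridiagonal pair with standard orderings `E` and `Es` of the primitive idempotents. -/
structure IsIdempotentPair {F V : Type*} [Field F] [AddCommGroup V] [Module F V]
    (A B : Module.End F V) (d : ℕ) (E Es : ℕ → Module.End F V) (θ θs : ℕ → F) : Prop where
  left : IsIdempotentSystem A B d E θ
  right : IsIdempotentSystem B A d Es θs
  irreducible : ∀ W : Submodule F V, W.map A ≤ W → W.map B ≤ W → W = ⊥ ∨ W = ⊤

namespace IsIdempotentPair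

open Finset

variable {F V : Type*} [Field F] [AddCommGroup V] [Module F V]
  {A B : Module.End F V} {d : ℕ} {E Es : ℕ → Module.End F V} {θ θs : ℕ → F}

theorem sub_smul_mem_flagSpace (h : IsIdempotentPair A B d E Es θ θs) {r i : ℕ} {v : V}
    (hv : v ∈ flagSpace E Es r i) : A v - θ (i + r) • v ∈ flagSpace E Es r (i + 1) := by
  rw [mem_flagSpace] at hv ⊢
  refine ⟨fun k hk => h.right.apply_dual_sub_smul_eq_zero _ fun j _ hj => hv.1 j (by omega),
    fun k hk => ?_⟩
  rw [h.left.apply_sub_smul]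
  rcases eq_or_ne k (i + r) with rfl | hne
  · rw [sub_self, zero_smul]
  · rw [hv.2 k (by omega), smul_zero]

theorem dual_sub_smul_mem_flagSpace (h : IsIdempotentPair A B d E Es θ θs) {r i : ℕ} {v : V}
    (hv : v ∈ flagSpace E Es r (i + 1)) : B v - θs (i + 1) • v ∈ flagSpace E Es r i := by
  rw [mem_flagSpace] at hv ⊢
  refine ⟨fun k hk => ?_,
    fun k hk => h.left.apply_dual_sub_smul_eq_zero _ fun j hj _ => hv.2 j (by omega)⟩
  rw [h.right.apply_sub_smul]
  rcases eq_or_ne k (i + 1) with rfl | hne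
  · rw [sub_self, zero_smul]
  · rw [hv.1 k (by omega), smul_zero]

theorem dual_zero_apply_of_mem_flagSpace (h : IsIdempotentPair A B d E Es θ θs) {r : ℕ} {v : V}
    (hv : v ∈ flagSpace E Es r 0) : Es 0 v = v :=
  h.right.apply_zero_eq_self (mem_flagSpace.1 hv).1

theorem map_iSup_flagSpace_le (h : IsIdempotentPair A B d E Es θ θs) (r : ℕ) :
    (⨆ i, flagSpace E Es r i).map A ≤ ⨆ i, flagSpace E Es r i := by
  rw [Submodule.map_iSup, iSup_le_iff]
  rintro i _ ⟨v, hv, rfl⟩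
  rw [← sub_add_cancel (A v) (θ (i + r) • v)]
  exact add_mem (Submodule.mem_iSup_of_mem _ (h.sub_smul_mem_flagSpace hv))
    (Submodule.smul_mem _ _ (Submodule.mem_iSup_of_mem i hv))

theorem map_dual_iSup_flagSpace_le (h : IsIdempotentPair A B d E Es θ θs) (r : ℕ) :
    (⨆ i, flagSpace E Es r i).map B ≤ ⨆ i, flagSpace E Es r i := by
  rw [Submodule.map_iSup, iSup_le_iff]
  rintro (_ | i) _ ⟨v, hv, rfl⟩
  · rw [← h.dual_zero_apply_of_mem_flagSpace hv, ← Module.End.mul_apply, h.right.left_mul,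
      LinearMap.smul_apply, h.dual_zero_apply_of_mem_flagSpace hv]
    exact Submodule.smul_mem _ _ (Submodule.mem_iSup_of_mem 0 hv)
  · rw [← sub_add_cancel (B v) (θs (i + 1) • v)]
    exact add_mem (Submodule.mem_iSup_of_mem i (h.dual_sub_smul_mem_flagSpace hv))
      (Submodule.smul_mem _ _ (Submodule.mem_iSup_of_mem _ hv))

theorem iSup_flagSpace_eq_bot_or_top (h : IsIdempotentPair A B d E Es θ θs) (r : ℕ) :
    ⨆ i, flagSpace E Es r i = ⊥ ∨ ⨆ i, flagSpace E Es r i = ⊤ :=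
  h.irreducible _ (h.map_iSup_flagSpace_le r) (h.map_dual_iSup_flagSpace_le r)

theorem flagSpace_one_eq_bot (h : IsIdempotentPair A B d E Es θ θs) (i : ℕ) :
    flagSpace E Es 1 i = ⊥ := by
  refine eq_bot_iff.2 ((le_iSup (flagSpace E Es 1) i).trans
    ((h.iSup_flagSpace_eq_bot_or_top 1).resolve_right fun htop => ?_).le)
  refine h.left.ne_zero 0 d.zero_le (LinearMap.ker_eq_top.1 (top_le_iff.1 ?_))
  rw [← htop]
  exact iSup_le fun i v hv => (mem_flagSpace.1 hv).2 0 (by omega)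

theorem mem_flagSpace_zero (h : IsIdempotentPair A B d E Es θ θs) {v : V} (hv : Es 0 v = v) :
    v ∈ flagSpace E Es 0 0 :=
  mem_flagSpace.2 ⟨fun k hk => by rw [← hv, h.right.apply_apply_of_ne hk.ne'],
    fun k hk => absurd hk k.not_lt_zero⟩

theorem iSup_flagSpace_zero_eq_top (h : IsIdempotentPair A B d E Es θ θs) :
    ⨆ i, flagSpace E Es 0 i = ⊤ := by
  refine (h.iSup_flagSpace_eq_bot_or_top 0).resolve_left fun hbot => ?_
  refine h.right.ne_zero 0 d.zero_le (LinearMap.ext fun v => ?_)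
  rw [LinearMap.zero_apply, ← Submodule.mem_bot F, ← hbot]
  exact Submodule.mem_iSup_of_mem 0 (h.mem_flagSpace_zero (h.right.apply_self_apply 0 v))

theorem eq_zero_of_apply_zero (h : IsIdempotentPair A B d E Es θ θs) {v : V} (hv : Es 0 v = v)
    (h₀ : E 0 v = 0) : v = 0 := by
  rw [← Submodule.mem_bot F, ← h.flagSpace_one_eq_bot 0, mem_flagSpace]
  refine ⟨(mem_flagSpace.1 (h.mem_flagSpace_zero hv)).1, fun k hk => ?_⟩
  obtain rfl : k = 0 := by omega
  exact h₀

theorem map_range_dual_zero (h : IsIdempotentPair A B d E Es θ θs) :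
    (LinearMap.range (Es 0)).map (E 0) = LinearMap.range (E 0) := by
  refine le_antisymm LinearMap.map_le_range ?_
  rw [LinearMap.range_eq_map (E 0), ← h.iSup_flagSpace_zero_eq_top, Submodule.map_iSup,
    iSup_le_iff]
  rintro (_ | i) _ ⟨v, hv, rfl⟩
  · exact ⟨v, ⟨v, h.dual_zero_apply_of_mem_flagSpace hv⟩, rfl⟩
  · rw [(mem_flagSpace.1 hv).2 0 i.succ_pos]
    exact zero_mem _

theorem finrank_range_zero (h : IsIdempotentPair A B d E Es θ θs) :
    Module.finrank F (LinearMap.range (E 0)) = Module.finrank F (LinearMap.range (Es 0)) := by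
  have hinj : Function.Injective ((E 0).domRestrict (LinearMap.range (Es 0))) := by
    rw [← LinearMap.ker_eq_bot, LinearMap.ker_eq_bot']
    rintro ⟨_, ⟨v, rfl⟩⟩ hv
    exact Subtype.ext (h.eq_zero_of_apply_zero (h.right.apply_self_apply 0 v) hv)
  rw [← h.map_range_dual_zero, ← LinearMap.range_domRestrict]
  exact LinearMap.finrank_range_of_inj hinj

theorem zero_mul_dual_zero_ne_zero (h : IsIdempotentPair A B d E Es θ θs) :
    E 0 * Es 0 ≠ 0 := by
  refine fun hzero => h.right.ne_zero 0 d.zero_le (LinearMap.ext fun v => ?_)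
  exact h.eq_zero_of_apply_zero (h.right.apply_self_apply 0 v) (LinearMap.congr_fun hzero v)

theorem aeval_nodal_mem_flagSpace (h : IsIdempotentPair A B d E Es θ θs) {v : V}
    (hv : Es 0 v = v) (k : ℕ) :
    aeval A (Lagrange.nodal (range k) θ) v ∈ flagSpace E Es 0 k := by
  induction k with
  | zero => simpa [Lagrange.nodal_empty] using h.mem_flagSpace_zero hv
  | succ k ih =>
    rw [range_add_one, Lagrange.nodal_insert_eq_nodal notMem_range_self, map_mul,
      Module.End.mul_apply]
    simpa [Module.algebraMap_end_apply] using h.sub_smul_mem_flagSpace ih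

theorem aeval_nodal_ne_zero (h : IsIdempotentPair A B d E Es θ θs)
    (hlast : ∀ v, Es 0 v = v → E d v = 0 → v = 0) {v : V} (hv : Es 0 v = v) (hne : v ≠ 0)
    {k : ℕ} (hk : k ≤ d) : aeval A (Lagrange.nodal (range k) θ) v ≠ 0 := by
  intro hzero
  have heval : (Lagrange.nodal (range k) θ).eval (θ d) • E d v = 0 := by
    rw [← LinearMap.smul_apply, ← h.left.mul_aeval, Module.End.mul_apply, hzero, map_zero]
  refine hne (hlast v hv ((smul_eq_zero.1 heval).resolve_left ?_))
  refine Lagrange.eval_nodal_not_at_node fun j hj heq => ?_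
  have hjd : j < d := (mem_range.1 hj).trans_le hk
  exact hjd.ne' (h.left.injOn (Set.mem_Iic.2 le_rfl) hjd.le heq)

theorem dual_mul_pow_mul_dual_zero_ne_zero (h : IsIdempotentPair A B d E Es θ θs)
    (hlast : ∀ v, Es 0 v = v → E d v = 0 → v = 0) {k : ℕ} (hk : k ≤ d) :
    Es k * A ^ k * Es 0 ≠ 0 := by
  intro hzero
  have hτ : Es k * aeval A (Lagrange.nodal (range k) θ) * Es 0 = 0 := by
    have hcoeff := h.right.mul_aeval_dual_mul_eq_coeff_smul
      (p := Lagrange.nodal (range k) θ) (n := k) (by simp) 0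
    rwa [zero_add, hzero, smul_zero] at hcoeff
  refine h.right.ne_zero 0 d.zero_le (LinearMap.ext fun v => ?_)
  by_contra hne
  have hv := h.right.apply_self_apply 0 v
  refine h.aeval_nodal_ne_zero hlast hv hne hk ?_
  have hmem := mem_flagSpace.1 (h.aeval_nodal_mem_flagSpace hv k)
  have hdual : ∀ j, k ≤ j → Es j (aeval A (Lagrange.nodal (range k) θ) (Es 0 v)) = 0 := by
    intro j hj
    rcases hj.eq_or_lt with rfl | hlt
    · exact LinearMap.congr_fun hτ v
    · exact hmem.1 j hlt
  cases k with
  | zero => rw [← h.right.sum_apply (aeval A _ _)]; exact sum_eq_zero fun j _ => hdual j j.zero_le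
  | succ k =>
    rw [← Submodule.mem_bot F, ← h.flagSpace_one_eq_bot k, mem_flagSpace]
    exact ⟨fun j hj => hdual j hj, hmem.2⟩

theorem dual_mul_pow_mul_dual_ne_zero (h : IsIdempotentPair A B d E Es θ θs)
    (hlast : ∀ v, Es 0 v = v → E d v = 0 → v = 0) {i n : ℕ} (hin : i + n ≤ d) :
    Es (i + n) * A ^ n * Es i ≠ 0 := by
  intro hzero
  have hfactor := h.right.mul_pow_add_mul (m := n) (n := i) (i := 0) (by omega)
  rw [zero_add, hzero, zero_mul, add_comm n i] at hfactor
  exact h.dual_mul_pow_mul_dual_zero_ne_zero hlast hin hfactor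

end IsIdempotentPair

section CubicDifference

variable {F : Type*} [Field F]

theorem exists_polynomial_eval_sub_eval {d : ℕ} {θ : ℕ → F} (hθ : Set.InjOn θ (Set.Iic d))
    (δ : ℕ → F) : ∃ f : F[X], f.natDegree ≤ d ∧
      ∀ i < d, f.eval (θ i) - f.eval (θ (i + 1)) = δ i := by
  let y : ℕ → F := fun n => -∑ i ∈ Finset.range n, δ i
  have hinj : Set.InjOn θ (Finset.range (d + 1)) := fun i hi j hj hij =>
    hθ (Finset.mem_range_succ_iff.1 hi) (Finset.mem_range_succ_iff.1 hj) hij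
  refine ⟨Lagrange.interpolate (Finset.range (d + 1)) θ y, ?_, fun i hi => ?_⟩
  · refine natDegree_le_of_degree_le ?_
    simpa using Lagrange.degree_interpolate_le y hinj
  · rw [Lagrange.eval_interpolate_at_node y hinj (Finset.mem_range_succ_iff.2 hi.le),
      Lagrange.eval_interpolate_at_node y hinj (Finset.mem_range_succ_iff.2 hi)]
    simp only [y, Finset.sum_range_succ]
    ring

theorem coeff_add_eq_mul_of_eval_sub_eval {f : F[X]} (hf : f.natDegree ≤ 3) {s t : F}
    (hst : s ≠ t) (h : f.eval s - f.eval t = s * t * (s - t)) :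
    f.coeff 1 + f.coeff 2 * (s + t) + f.coeff 3 * (s ^ 2 + s * t + t ^ 2) = s * t := by
  refine mul_left_cancel₀ (sub_ne_zero.2 hst) ?_
  have heval : ∀ x, f.eval x =
      f.coeff 0 + f.coeff 1 * x + f.coeff 2 * x ^ 2 + f.coeff 3 * x ^ 3 := fun x => by
    simp [eval_eq_sum_range' (Nat.lt_succ_of_le hf), Finset.sum_range_succ]
  rw [heval, heval] at h
  linear_combination h

theorem coeff_add_eq_middle_of_eval_sub_eval {f : F[X]} (hf : f.natDegree ≤ 3) {s t u : F}
    (hst : s ≠ t) (htu : t ≠ u) (hsu : s ≠ u) (h : f.eval s - f.eval t = s * t * (s - t))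
    (h' : f.eval t - f.eval u = t * u * (t - u)) :
    f.coeff 2 + f.coeff 3 * (s + t + u) = t := by
  refine mul_left_cancel₀ (sub_ne_zero.2 hsu) ?_
  linear_combination coeff_add_eq_mul_of_eval_sub_eval hf hst h -
    coeff_add_eq_mul_of_eval_sub_eval hf htu h'

theorem sub_eq_coeff_three_mul_sub {f : F[X]} (hf : f.natDegree ≤ 3) {d : ℕ} {θ : ℕ → F}
    (hθ : Set.InjOn θ (Set.Iic d))
    (h : ∀ i < d, f.eval (θ i) - f.eval (θ (i + 1)) = θ i * θ (i + 1) * (θ i - θ (i + 1)))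
    {k : ℕ} (hk : k + 3 ≤ d) :
    θ (k + 1) - θ (k + 2) = f.coeff 3 * (θ k - θ (k + 3)) := by
  have hne : ∀ i j, i < j → j ≤ d → θ i ≠ θ j := fun i j hij hj heq =>
    hij.ne (hθ (hij.le.trans hj) hj heq)
  have hmiddle : ∀ i, i + 2 ≤ d →
      f.coeff 2 + f.coeff 3 * (θ i + θ (i + 1) + θ (i + 2)) = θ (i + 1) := fun i hi =>
    coeff_add_eq_middle_of_eval_sub_eval hf (hne _ _ (by omega) (by omega))
      (hne _ _ (by omega) hi) (hne _ _ (by omega) hi) (h i (by omega)) (h (i + 1) (by omega))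
  linear_combination hmiddle (k + 1) hk - hmiddle k (by omega)

end CubicDifference

namespace IsIdempotentSystem

variable {F V : Type*} [Field F] [AddCommGroup V] [Module F V]
  {A B : Module.End F V} {d : ℕ} {E : ℕ → Module.End F V} {θ : ℕ → F}

theorem commutator_eq (h : IsIdempotentSystem A B d E θ) {f : F[X]}
    (hf : ∀ i < d, f.eval (θ i) - f.eval (θ (i + 1)) = θ i * θ (i + 1) * (θ i - θ (i + 1))) :
    A ^ 2 * B * A ^ 1 - A ^ 1 * B * A ^ 2 = aeval A f * B - B * aeval A f := by
  refine h.ext fun i j => ?_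
  have hleft : E i * (A ^ 2 * B * A ^ 1 - A ^ 1 * B * A ^ 2) * E j =
      (θ i * θ j * (θ i - θ j)) • (E i * B * E j) := by
    have h₁ := h.mul_aeval_mul_aeval_mul (X ^ 2) (X ^ 1) B i j
    have h₂ := h.mul_aeval_mul_aeval_mul (X ^ 1) (X ^ 2) B i j
    simp only [map_pow, aeval_X, eval_pow, eval_X] at h₁ h₂
    rw [mul_sub, sub_mul, h₁, h₂, ← sub_smul]
    congr 1
    ring
  have hright : E i * (aeval A f * B - B * aeval A f) * E j =
      (f.eval (θ i) - f.eval (θ j)) • (E i * B * E j) := by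
    have h₁ := h.mul_aeval_mul_aeval_mul f 1 B i j
    have h₂ := h.mul_aeval_mul_aeval_mul 1 f B i j
    simp only [map_one, eval_one, mul_one, one_mul] at h₁ h₂
    rw [mul_sub, sub_mul, h₁, h₂, ← sub_smul]
  rw [hleft, hright]
  rcases lt_or_ge d i with hi | hi
  · simp only [h.eq_zero i hi, zero_mul, smul_zero]
  rcases lt_or_ge d j with hj | hj
  · simp only [h.eq_zero j hj, mul_zero, smul_zero]
  by_cases hij : i + 1 < j ∨ j + 1 < i
  · rw [h.tri i j hij, smul_zero, smul_zero]
  obtain rfl | rfl | rfl : i = j ∨ j = i + 1 ∨ i = j + 1 := by omega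
  · rw [sub_self, sub_self, mul_zero]
  · rw [hf i hj]
  · congr 1
    linear_combination hf j hi

theorem mul_commutator_mul (h : IsIdempotentSystem A B d E θ) {f : F[X]} {n : ℕ}
    (hn : f.natDegree ≤ n) (i : ℕ) : E (i + n) * (aeval B f * A - A * aeval B f) * E i =
      ((θ i - θ (i + n)) * f.coeff n) • (E (i + n) * B ^ n * E i) := by
  have hsub : E (i + n) * (aeval B f * A - A * aeval B f) * E i =
      E (i + n) * aeval B f * (A * E i) - E (i + n) * A * aeval B f * E i := by noncomm_ring
  rw [hsub, h.left_mul, h.mul_left, mul_smul_comm, smul_mul_assoc, smul_mul_assoc, ← sub_smul,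
    h.mul_aeval_dual_mul_eq_coeff_smul hn, smul_smul]

theorem natDegree_le_three (h : IsIdempotentSystem A B d E θ)
    (hne : ∀ i n, i + n ≤ d → E (i + n) * B ^ n * E i ≠ 0) {f : F[X]} (hfd : f.natDegree ≤ d)
    (hf : B ^ 2 * A * B ^ 1 - B ^ 1 * A * B ^ 2 = aeval B f * A - A * aeval B f) :
    f.natDegree ≤ 3 := by
  by_contra! hlt
  have hpow : ∀ m n, n + m = 3 →
      E (0 + f.natDegree) * (B ^ m * A * B ^ n) * E 0 = 0 := fun m n hmn => by
    have hX := h.mul_pow_mul_aeval_mul_pow_mul_eq_zero X (m := m) (n := n) (i := 0)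
      (j := 0 + f.natDegree) (by omega)
    rwa [aeval_X] at hX
  have hcoeff := h.mul_commutator_mul (le_refl f.natDegree) 0
  rw [← hf, mul_sub, sub_mul, hpow 2 1 rfl, hpow 1 2 rfl, sub_zero, eq_comm, smul_eq_zero] at hcoeff
  have hθ : θ 0 - θ (0 + f.natDegree) ≠ 0 := fun heq => by
    have := h.injOn d.zero_le (by simpa using hfd) (sub_eq_zero.1 heq)
    omega
  have hlead : f.coeff f.natDegree ≠ 0 := by
    rw [coeff_natDegree, leadingCoeff_ne_zero]
    rintro rfl
    simp at hlt
  exact hcoeff.elim (mul_ne_zero hθ hlead) (hne _ _ (by omega))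

theorem sub_eq_sub_mul_coeff_three (h : IsIdempotentSystem A B d E θ)
    (hne : ∀ i n, i + n ≤ d → E (i + n) * B ^ n * E i ≠ 0) {f : F[X]} (hf₃ : f.natDegree ≤ 3)
    (hf : B ^ 2 * A * B ^ 1 - B ^ 1 * A * B ^ 2 = aeval B f * A - A * aeval B f)
    {k : ℕ} (hk : k + 3 ≤ d) : θ (k + 1) - θ (k + 2) = (θ k - θ (k + 3)) * f.coeff 3 := by
  have h₁ := h.mul_pow_mul_left_mul_pow_mul (m := 2) (n := 1) (i := k) (by omega)
  have h₂ := h.mul_pow_mul_left_mul_pow_mul (m := 1) (n := 2) (i := k) (by omega)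
  have hcoeff := h.mul_commutator_mul hf₃ k
  rw [← hf, mul_sub, sub_mul] at hcoeff
  refine smul_left_injective F (hne k 3 hk) ?_
  simp only [← hcoeff, sub_smul]
  exact (congrArg₂ (· - ·) h₁ h₂).symm

end IsIdempotentSystem

theorem IsIdempotentPair.exists_base {F V : Type*} [Field F] [AddCommGroup V] [Module F V]
    {A B : Module.End F V} {d : ℕ} {E Es : ℕ → Module.End F V} {θ θs : ℕ → F}
    (h : IsIdempotentPair A B d E Es θ θs) (hlast : ∀ v, Es 0 v = v → E d v = 0 → v = 0)
    (hd : 3 ≤ d) : ∃ β : F, ∀ k, k + 3 ≤ d →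
      θ k - θ (k + 3) = (β + 1) * (θ (k + 1) - θ (k + 2)) ∧
      θs k - θs (k + 3) = (β + 1) * (θs (k + 1) - θs (k + 2)) := by
  have hne : ∀ i n, i + n ≤ d → Es (i + n) * A ^ n * Es i ≠ 0 := fun i n hin =>
    h.dual_mul_pow_mul_dual_ne_zero hlast hin
  obtain ⟨f, hfd, hstep⟩ := exists_polynomial_eval_sub_eval h.left.injOn
    fun i => θ i * θ (i + 1) * (θ i - θ (i + 1))
  have hf := h.left.commutator_eq hstep
  have hf₃ := h.right.natDegree_le_three hne hfd hf
  have hdual : ∀ k, k + 3 ≤ d → θs (k + 1) - θs (k + 2) = (θs k - θs (k + 3)) * f.coeff 3 :=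
    fun k hk => h.right.sub_eq_sub_mul_coeff_three hne hf₃ hf hk
  have hc : f.coeff 3 ≠ 0 := fun hc => by
    have hθs : θs 1 = θs 2 := sub_eq_zero.1 (by rw [hdual 0 hd, hc, mul_zero])
    have := h.right.injOn (Set.mem_Iic.2 (by omega)) (Set.mem_Iic.2 (by omega)) hθs
    omega
  refine ⟨(f.coeff 3)⁻¹ - 1, fun k hk => ?_⟩
  rw [hdual k hk, sub_eq_coeff_three_mul_sub hf₃ h.left.injOn hstep hk, sub_add_cancel,
    inv_mul_cancel_left₀ hc, mul_comm (θs k - _), inv_mul_cancel_left₀ hc]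
  exact ⟨rfl, rfl⟩

theorem degree_nodal_sub_nodal_lt {F ι : Type*} [Field F] (s : Finset ι) (v w : ι → F) :
    (Lagrange.nodal s v - Lagrange.nodal s w).degree < s.card := by
  have hdeg := degree_sub_lt_left
    (Lagrange.degree_nodal.trans Lagrange.degree_nodal.symm :
      (Lagrange.nodal s v).degree = (Lagrange.nodal s w).degree)
    Lagrange.nodal_ne_zero
    (Lagrange.nodal_monic.leadingCoeff.trans Lagrange.nodal_monic.leadingCoeff.symm)
  rwa [Lagrange.degree_nodal] at hdeg

theorem eval_nodal_range_succ {F : Type*} [Field F] (θ : ℕ → F) {i k : ℕ} (hk : k ≠ 0)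
    (hki : k ≤ i) : (Lagrange.nodal (Finset.range i) fun j => θ (j + 1)).eval (θ k) = 0 := by
  obtain ⟨k, rfl⟩ := Nat.exists_eq_succ_of_ne_zero hk
  exact Lagrange.eval_nodal_at_node (v := fun j => θ (j + 1)) (Finset.mem_range.2 hki)

theorem exists_mul_mul_eq_smul {F V : Type*} [Field F] [AddCommGroup V] [Module F V]
    {P : Module.End F V} (hP : Module.finrank F (LinearMap.range P) = 1) (Z : Module.End F V) :
    ∃ c : F, P * Z * P = c • P := by
  obtain ⟨⟨v, hv⟩, -, hspan⟩ := finrank_eq_one_iff'.1 hP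
  obtain ⟨c, hc⟩ := hspan ⟨P (Z v), LinearMap.mem_range_self _ _⟩
  have hPZv : P (Z v) = c • v := (congrArg Subtype.val hc).symm
  refine ⟨c, LinearMap.ext fun u => ?_⟩
  obtain ⟨a, ha⟩ := hspan ⟨P u, LinearMap.mem_range_self _ _⟩
  have hPu : P u = a • v := (congrArg Subtype.val ha).symm
  rw [Module.End.mul_apply, Module.End.mul_apply, LinearMap.smul_apply, hPu, map_smul, map_smul,
    hPZv, smul_comm]

namespace IsIdempotentSystem

open Finset

variable {F V : Type*} [Field F] [AddCommGroup V] [Module F V]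
  {A B Z : Module.End F V} {d i : ℕ} {E : ℕ → Module.End F V} {θ : ℕ → F}

theorem aeval_nodal_mul_eq_zero (h : IsIdempotentSystem A B d E θ)
    (hZ : ∀ k, i ≤ k → E k * Z = 0) : aeval A (Lagrange.nodal (range i) θ) * Z = 0 := by
  rw [h.aeval_eq_sum, sum_mul]
  refine sum_eq_zero fun k _ => ?_
  rcases lt_or_ge k i with hk | hk
  · rw [Lagrange.eval_nodal_at_node (mem_range.2 hk), zero_smul, zero_mul]
  · rw [smul_mul_assoc, hZ k hk, smul_zero]

theorem mul_aeval_nodal_eq_zero (h : IsIdempotentSystem A B d E θ)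
    (hZ : ∀ k, i ≤ k → Z * E k = 0) : Z * aeval A (Lagrange.nodal (range i) θ) = 0 := by
  rw [h.aeval_eq_sum, mul_sum]
  refine sum_eq_zero fun k _ => ?_
  rcases lt_or_ge k i with hk | hk
  · rw [Lagrange.eval_nodal_at_node (mem_range.2 hk), zero_smul, mul_zero]
  · rw [mul_smul_comm, hZ k hk, smul_zero]

theorem aeval_nodal_succ_mul (h : IsIdempotentSystem A B d E θ)
    (hZ : ∀ k, i < k → E k * Z = 0) :
    aeval A (Lagrange.nodal (range i) fun j => θ (j + 1)) * Z =
      (∏ j ∈ range i, (θ 0 - θ (j + 1))) • (E 0 * Z) := by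
  rw [h.aeval_eq_sum, sum_mul, sum_eq_single_of_mem 0 (mem_range.2 d.succ_pos),
    Lagrange.eval_nodal, smul_mul_assoc]
  intro k _ hk
  rcases le_or_gt k i with hki | hki
  · rw [eval_nodal_range_succ θ hk hki, zero_smul, zero_mul]
  · rw [smul_mul_assoc, hZ k hki, smul_zero]

theorem mul_aeval_nodal_succ (h : IsIdempotentSystem A B d E θ)
    (hZ : ∀ k, i < k → Z * E k = 0) :
    Z * aeval A (Lagrange.nodal (range i) fun j => θ (j + 1)) =
      (∏ j ∈ range i, (θ 0 - θ (j + 1))) • (Z * E 0) := by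
  rw [h.aeval_eq_sum, mul_sum, sum_eq_single_of_mem 0 (mem_range.2 d.succ_pos),
    Lagrange.eval_nodal, mul_smul_comm]
  intro k _ hk
  rcases le_or_gt k i with hki | hki
  · rw [eval_nodal_range_succ θ hk hki, zero_smul, mul_zero]
  · rw [mul_smul_comm, hZ k hki, smul_zero]

theorem aeval_nodal_succ_mul_aeval_nodal_mul (h : IsIdempotentSystem A B d E θ) (θs : ℕ → F)
    (i : ℕ) :
    aeval A (Lagrange.nodal (range i) fun j => θ (j + 1)) *
        aeval B (Lagrange.nodal (range i) θs) * E 0 =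
      (∏ j ∈ range i, (θ 0 - θ (j + 1))) •
        (E 0 * aeval B (Lagrange.nodal (range i) θs) * E 0) := by
  rw [mul_assoc, h.aeval_nodal_succ_mul, mul_assoc]
  intro k hk
  rw [← mul_assoc]
  refine h.mul_aeval_dual_mul_eq_zero (n := i + 1) ?_ (by omega)
  simpa using Nat.cast_lt.2 i.lt_succ_self

theorem mul_aeval_nodal_mul_aeval_nodal_succ (h : IsIdempotentSystem A B d E θ) (θs : ℕ → F)
    (i : ℕ) :
    E 0 * aeval B (Lagrange.nodal (range i) θs) *
        aeval A (Lagrange.nodal (range i) fun j => θ (j + 1)) =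
      (∏ j ∈ range i, (θ 0 - θ (j + 1))) •
        (E 0 * aeval B (Lagrange.nodal (range i) θs) * E 0) := by
  refine h.mul_aeval_nodal_succ fun k hk => ?_
  refine h.mul_aeval_dual_mul_eq_zero (n := i + 1) ?_ (by omega)
  simpa using Nat.cast_lt.2 i.lt_succ_self

end IsIdempotentSystem

theorem IsIdempotentPair.split_eigenvalue_eq {F V : Type*} [Field F] [AddCommGroup V]
    [Module F V] {A B : Module.End F V} {d : ℕ} {E Es : ℕ → Module.End F V} {θ θs : ℕ → F}
    (h : IsIdempotentPair A B d E Es θ θs) {i : ℕ} {z z' : F}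
    (hz : aeval B (Lagrange.nodal (Finset.range i) fun j => θs (j + 1)) *
      aeval A (Lagrange.nodal (Finset.range i) θ) * Es 0 = z • Es 0)
    (hz' : aeval A (Lagrange.nodal (Finset.range i) fun j => θ (j + 1)) *
      aeval B (Lagrange.nodal (Finset.range i) θs) * E 0 = z' • E 0) : z = z' := by
  set τ := aeval A (Lagrange.nodal (Finset.range i) θ)
  set σ := aeval A (Lagrange.nodal (Finset.range i) fun j => θ (j + 1))
  set τs := aeval B (Lagrange.nodal (Finset.range i) θs)
  set σs := aeval B (Lagrange.nodal (Finset.range i) fun j => θs (j + 1))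
  have hdeg : ∀ θ : ℕ → F, (Lagrange.nodal (Finset.range i) (fun j => θ (j + 1)) -
      Lagrange.nodal (Finset.range i) θ).degree < i := fun θ => by
    simpa using degree_nodal_sub_nodal_lt (Finset.range i) (fun j => θ (j + 1)) θ
  have hright : E 0 * (σs - τs) * τ = 0 := by
    refine h.left.mul_aeval_nodal_eq_zero fun k hk => ?_
    rw [← map_sub, h.left.mul_aeval_dual_mul_eq_zero (hdeg θs) (by omega)]
  have hleft : τs * ((σ - τ) * Es 0) = 0 := by
    refine h.right.aeval_nodal_mul_eq_zero fun k hk => ?_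
    rw [← map_sub, ← mul_assoc, h.right.mul_aeval_dual_mul_eq_zero (hdeg θ) (by omega)]
  have hz₀ : E 0 * τs * σ = z' • E 0 := by
    rw [h.left.mul_aeval_nodal_mul_aeval_nodal_succ, ← hz',
      h.left.aeval_nodal_succ_mul_aeval_nodal_mul]
  refine smul_left_injective F h.zero_mul_dual_zero_ne_zero ?_
  calc z • (E 0 * Es 0) = E 0 * σs * τ * Es 0 := by
        rw [← mul_smul_comm, ← hz]
        simp only [mul_assoc]
    _ = E 0 * τs * τ * Es 0 := by
        rw [mul_sub, sub_mul, sub_eq_zero] at hright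
        rw [hright]
    _ = E 0 * τs * σ * Es 0 := by
        rw [sub_mul, mul_sub, sub_eq_zero] at hleft
        rw [mul_assoc, mul_assoc, ← hleft, mul_assoc, mul_assoc]
    _ = z' • (E 0 * Es 0) := by rw [hz₀, smul_mul_assoc]

/-! ### Tridiagonal systems -/

/-- Extension of a finite sequence by zero; it turns data indexed by `Fin (d + 1)` into data indexed
by `ℕ`. -/
def extendZero {M : Type*} [Zero M] {d : ℕ} (f : Fin (d + 1) → M) (k : ℕ) : M :=
  if h : k < d + 1 then f ⟨k, h⟩ else 0

section ExtendZero

variable {M : Type*} [Zero M] {d k : ℕ}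

theorem extendZero_of_le (f : Fin (d + 1) → M) (h : k ≤ d) :
    extendZero f k = f ⟨k, Nat.lt_succ_of_le h⟩ := dif_pos _

theorem extendZero_val (f : Fin (d + 1) → M) (i : Fin (d + 1)) : extendZero f i = f i :=
  dif_pos i.isLt

theorem extendZero_of_lt (f : Fin (d + 1) → M) (h : d < k) : extendZero f k = 0 :=
  dif_neg (by omega)

theorem extendZero_zero (f : Fin (d + 1) → M) : extendZero f 0 = f 0 := extendZero_val f 0

theorem extendZero_last (f : Fin (d + 1) → M) : extendZero f d = f (Fin.last d) :=
  extendZero_val f (Fin.last d)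

theorem extendZero_rev (f : Fin (d + 1) → M) (h : k ≤ d) :
    extendZero (fun i => f (Fin.rev i)) k = extendZero f (d - k) := by
  rw [extendZero_of_le _ h, extendZero_of_le _ (Nat.sub_le d k)]
  congr 1
  ext
  simp [Fin.val_rev]

theorem forall_extendZero {p : ℕ → M → Prop} (f : Fin (d + 1) → M)
    (hle : ∀ i : Fin (d + 1), p i (f i)) (hlt : ∀ k, d < k → p k 0) (k : ℕ) :
    p k (extendZero f k) := by
  rcases le_or_gt k d with hk | hk
  · simpa only [extendZero_of_le f hk] using hle ⟨k, Nat.lt_succ_of_le hk⟩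
  · simpa only [extendZero_of_lt f hk] using hlt k hk

end ExtendZero

section FinIntervals

variable {M : Type*} [CommMonoid M] {d : ℕ}

theorem prod_Iio_fin (g : ℕ → M) (i : Fin (d + 1)) :
    ∏ j ∈ Finset.Iio i, g j = ∏ k ∈ Finset.range i, g k := by
  have hmap := Finset.prod_map (Finset.Iio i) Fin.valEmbedding g
  rw [Fin.map_valEmbedding_Iio, Nat.Iio_eq_range] at hmap
  exact hmap.symm

theorem prod_Ioc_zero_fin (g : ℕ → M) (i : Fin (d + 1)) :
    ∏ j ∈ Finset.Ioc 0 i, g j = ∏ k ∈ Finset.range i, g (k + 1) := by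
  have hmap := Finset.prod_map (Finset.Ioc 0 i) Fin.valEmbedding g
  rw [Fin.map_valEmbedding_Ioc] at hmap
  refine hmap.symm.trans ?_
  rw [Finset.range_eq_Ico, Finset.prod_Ico_add' g 0 i 1]
  refine Finset.prod_congr (Finset.ext fun k => ?_) fun _ _ => rfl
  simp only [Finset.mem_Ioc, Finset.mem_Ico, Fin.val_zero]
  omega

theorem prod_Ioi_fin (g : ℕ → M) (i : Fin (d + 1)) :
    ∏ j ∈ Finset.Ioi i, g j = ∏ k ∈ Finset.Ico (i : ℕ) d, g (k + 1) := by
  have hmap := Finset.prod_map (Finset.Ioi i) Fin.valEmbedding g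
  rw [Fin.map_valEmbedding_Ioi] at hmap
  refine hmap.symm.trans ?_
  rw [Finset.prod_Ico_add' g i d 1]
  refine Finset.prod_congr (Finset.ext fun k => ?_) fun _ _ => rfl
  simp only [Finset.mem_Ioo, Finset.mem_Ico]
  omega

end FinIntervals

namespace IsStandardIdempotents

variable {F V : Type*} [Field F] [AddCommGroup V] [Module F V] {A B : Module.End F V} {d : ℕ}
  {E : Fin (d + 1) → Module.End F V} {θ : Fin (d + 1) → F}

theorem mul_self (h : IsStandardIdempotents A B E) (i : Fin (d + 1)) : E i * E i = E i :=
  LinearMap.ext fun _ => h.apply_self i _ (LinearMap.mem_range_self _ _)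

theorem mul_of_ne (h : IsStandardIdempotents A B E) {i j : Fin (d + 1)} (hij : i ≠ j) :
    E i * E j = 0 :=
  LinearMap.ext fun _ => h.apply_of_ne i j hij.symm _ (LinearMap.mem_range_self _ _)

theorem ne_zero (h : IsStandardIdempotents A B E) (i : Fin (d + 1)) : E i ≠ 0 := fun hE =>
  ((h.standard.1.2 _).2 ⟨i, rfl⟩).1 (LinearMap.range_eq_bot.2 hE)

theorem sum_eq_one (h : IsStandardIdempotents A B E) (hdiag : IsDiagonalizableEnd A) :
    ∑ i, E i = 1 := by
  have htop : ⊤ ≤ LinearMap.eqLocus (∑ i, E i) 1 := by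
    rw [← hdiag]
    refine sSup_le fun U hU => ?_
    obtain ⟨j, rfl⟩ := (h.standard.1.2 U).1 hU
    rintro _ ⟨v, rfl⟩
    rw [LinearMap.mem_eqLocus, ← Module.End.mul_apply, Finset.sum_mul,
      Finset.sum_eq_single_of_mem j (Finset.mem_univ _) fun i _ hij => h.mul_of_ne hij,
      h.mul_self, Module.End.one_apply]
  exact LinearMap.ext fun v => htop Submodule.mem_top

theorem mul_mul_eq_zero (h : IsStandardIdempotents A B E) {i j : Fin (d + 1)}
    (hij : (i : ℕ) + 1 < j ∨ (j : ℕ) + 1 < i) : E i * B * E j = 0 := by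
  have hker : (⨆ k : {k : Fin (d + 1) // (k : ℕ) ≤ (j : ℕ) + 1 ∧ (j : ℕ) ≤ (k : ℕ) + 1},
      LinearMap.range (E k)) ≤ LinearMap.ker (E i) := by
    rw [iSup_le_iff]
    rintro ⟨k, hk⟩ _ ⟨u, rfl⟩
    refine h.apply_of_ne i k ?_ _ (LinearMap.mem_range_self _ _)
    rintro rfl
    omega
  exact LinearMap.ext fun v =>
    hker (h.standard.2 j (Submodule.mem_map_of_mem (LinearMap.mem_range_self _ v)))

theorem left_mul (hθ : ∀ i, LinearMap.range (E i) = A.eigenspace (θ i)) (i : Fin (d + 1)) :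
    A * E i = θ i • E i :=
  LinearMap.ext fun v => Module.End.mem_eigenspace_iff.1 (hθ i ▸ LinearMap.mem_range_self (E i) v)

theorem mul_left (h : IsStandardIdempotents A B E) (hdiag : IsDiagonalizableEnd A)
    (hθ : ∀ i, LinearMap.range (E i) = A.eigenspace (θ i)) (i : Fin (d + 1)) :
    E i * A = θ i • E i := by
  have hA : A = ∑ j, θ j • E j := by
    simp only [← left_mul hθ, ← Finset.mul_sum, h.sum_eq_one hdiag, mul_one]
  rw [hA, Finset.mul_sum, Finset.sum_eq_single_of_mem i (Finset.mem_univ _), mul_smul_comm,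
    h.mul_self]
  intro j _ hj
  rw [mul_smul_comm, h.mul_of_ne hj.symm, smul_zero]

theorem injective_eigenvalue (h : IsStandardIdempotents A B E)
    (hθ : ∀ i, LinearMap.range (E i) = A.eigenspace (θ i)) : Function.Injective θ :=
  fun i j hij => h.standard.1.1 ((hθ i).trans ((congrArg _ hij).trans (hθ j).symm))

theorem isIdempotentSystem (h : IsStandardIdempotents A B E) (hdiag : IsDiagonalizableEnd A)
    (hθ : ∀ i, LinearMap.range (E i) = A.eigenspace (θ i)) :
    IsIdempotentSystem A B d (extendZero E) (extendZero θ) where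
  sum_eq := by
    rw [Finset.sum_range, ← h.sum_eq_one hdiag]
    exact Finset.sum_congr rfl fun i _ => extendZero_val E i
  mul_self := forall_extendZero (p := fun _ e => e * e = e) E h.mul_self fun _ _ => mul_zero 0
  mul_of_ne i j := forall_extendZero (p := fun i e => i ≠ j → e * extendZero E j = 0) E
    (fun i => forall_extendZero (p := fun j e => (i : ℕ) ≠ j → E i * e = 0) E
      (fun _ hij => h.mul_of_ne fun heq => hij (congrArg Fin.val heq))
      (fun _ _ _ => mul_zero _) j)
    (fun _ _ _ => zero_mul _) i
  left_mul := forall_extendZero (p := fun k e => A * e = extendZero θ k • e) E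
    (fun i => (extendZero_val θ i).symm ▸ left_mul hθ i) fun _ _ => by rw [mul_zero, smul_zero]
  mul_left := forall_extendZero (p := fun k e => e * A = extendZero θ k • e) E
    (fun i => (extendZero_val θ i).symm ▸ h.mul_left hdiag hθ i)
    fun _ _ => by rw [zero_mul, smul_zero]
  ne_zero k hk := by
    rw [extendZero_of_le E hk]
    exact h.ne_zero _
  eq_zero _ hk := extendZero_of_lt E hk
  injOn i hi j hj hij := by
    rw [extendZero_of_le θ hi, extendZero_of_le θ hj] at hij
    exact congrArg Fin.val (h.injective_eigenvalue hθ hij)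
  tri i j := forall_extendZero
    (p := fun i e => i + 1 < j ∨ j + 1 < i → e * B * extendZero E j = 0) E
    (fun i => forall_extendZero
      (p := fun j e => (i : ℕ) + 1 < j ∨ j + 1 < (i : ℕ) → E i * B * e = 0) E
      (fun _ hij => h.mul_mul_eq_zero hij) (fun _ _ _ => mul_zero _) j)
    (fun _ _ _ => by rw [zero_mul, zero_mul]) i

end IsStandardIdempotents

namespace TridiagonalSystem

variable {F V : Type*} [Field F] [AddCommGroup V] [Module F V] {d : ℕ}

theorem isIdempotentSystem (Φ : TridiagonalSystem F V d) :
    IsIdempotentSystem Φ.A Φ.Astar d (extendZero Φ.E) (extendZero Φ.eigenvalue) :=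
  Φ.standard.isIdempotentSystem Φ.pair.diag Φ.range_eq_eigenspace

theorem isIdempotentPair (Φ : TridiagonalSystem F V d) :
    IsIdempotentPair Φ.A Φ.Astar d (extendZero Φ.E) (extendZero Φ.Estar)
      (extendZero Φ.eigenvalue) (extendZero Φ.dualEigenvalue) :=
  ⟨Φ.isIdempotentSystem, Φ.star.isIdempotentSystem, Φ.pair.irreducible⟩

theorem eigenvalue_eq {Φ Ψ : TridiagonalSystem F V d} (hA : Ψ.A = Φ.A) {i j : Fin (d + 1)}
    (hE : Ψ.E i = Φ.E j) : Ψ.eigenvalue i = Φ.eigenvalue j := by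
  refine smul_left_injective F (Φ.standard.ne_zero j) ?_
  change _ • Φ.E j = _ • Φ.E j
  rw [← IsStandardIdempotents.left_mul Φ.range_eq_eigenspace j, ← hA, ← hE,
    IsStandardIdempotents.left_mul Ψ.range_eq_eigenspace i]

theorem star_eigenvalue (Φ : TridiagonalSystem F V d) :
    Φ.star.eigenvalue = Φ.dualEigenvalue := rfl

theorem star_dualEigenvalue (Φ : TridiagonalSystem F V d) :
    Φ.star.dualEigenvalue = Φ.eigenvalue := rfl

theorem ddown_eigenvalue (Φ : TridiagonalSystem F V d) :
    Φ.ddown.eigenvalue = fun i => Φ.eigenvalue (Fin.rev i) :=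
  funext fun _ => eigenvalue_eq rfl rfl

theorem ddown_dualEigenvalue (Φ : TridiagonalSystem F V d) :
    Φ.ddown.dualEigenvalue = Φ.dualEigenvalue :=
  funext fun _ => eigenvalue_eq (Φ := Φ.star) (Ψ := Φ.ddown.star) rfl rfl

theorem finrank_E_zero (Φ : TridiagonalSystem F V d) :
    Module.finrank F (LinearMap.range (Φ.E 0)) =
      Module.finrank F (LinearMap.range (Φ.Estar 0)) := by
  rw [← extendZero_zero Φ.E, ← extendZero_zero Φ.Estar, Φ.isIdempotentPair.finrank_range_zero]

theorem IsSharp.star {Φ : TridiagonalSystem F V d} (h : Φ.IsSharp) : Φ.star.IsSharp :=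
  Φ.finrank_E_zero.symm.trans h

theorem IsSharp.ddown {Φ : TridiagonalSystem F V d} (h : Φ.IsSharp) : Φ.ddown.IsSharp :=
  Φ.ddown.finrank_E_zero.trans h.star

theorem eq_zero_of_apply_last (Φ : TridiagonalSystem F V d) (v : V)
    (hv : extendZero Φ.Estar 0 v = v) (h₀ : extendZero Φ.E d v = 0) : v = 0 := by
  refine Φ.ddown.isIdempotentPair.eq_zero_of_apply_zero hv ?_
  exact (extendZero_rev Φ.E (Nat.zero_le d)).symm ▸ h₀

theorem isBase_iff_eigenvalue (Φ : TridiagonalSystem F V d) (β : F) {k : ℕ} (hk : k + 3 ≤ d) :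
    (Φ.eigenvalue ⟨k, by omega⟩ - Φ.eigenvalue ⟨k + 3, by omega⟩) /
        (Φ.eigenvalue ⟨k + 1, by omega⟩ - Φ.eigenvalue ⟨k + 2, by omega⟩) = β + 1 ↔
      extendZero Φ.eigenvalue k - extendZero Φ.eigenvalue (k + 3) =
        (β + 1) * (extendZero Φ.eigenvalue (k + 1) - extendZero Φ.eigenvalue (k + 2)) := by
  have hne : extendZero Φ.eigenvalue (k + 1) - extendZero Φ.eigenvalue (k + 2) ≠ 0 :=
    sub_ne_zero.2 (Φ.isIdempotentSystem.injOn.ne (Set.mem_Iic.2 (by omega))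
      (Set.mem_Iic.2 (by omega)) (by omega))
  rw [← div_eq_iff hne, extendZero_of_le _ (by omega), extendZero_of_le _ (by omega),
    extendZero_of_le _ (by omega), extendZero_of_le _ (by omega)]

theorem isBase_iff (Φ : TridiagonalSystem F V d) (β : F) :
    Φ.IsBase β ↔ (∀ k, k + 3 ≤ d →
      extendZero Φ.eigenvalue k - extendZero Φ.eigenvalue (k + 3) =
        (β + 1) * (extendZero Φ.eigenvalue (k + 1) - extendZero Φ.eigenvalue (k + 2)) ∧
      extendZero Φ.dualEigenvalue k - extendZero Φ.dualEigenvalue (k + 3) =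
        (β + 1) * (extendZero Φ.dualEigenvalue (k + 1) - extendZero Φ.dualEigenvalue (k + 2))) ∧
      (d ≤ 2 → β ≠ 0) :=
  and_congr_left fun _ => forall_congr' fun _ => forall_congr' fun hk =>
    and_congr (Φ.isBase_iff_eigenvalue β hk) (Φ.star.isBase_iff_eigenvalue β hk)

theorem exists_isBase (Φ : TridiagonalSystem F V d) : ∃ β : F, Φ.IsBase β := by
  by_cases hd : 3 ≤ d
  · obtain ⟨β, hβ⟩ := Φ.isIdempotentPair.exists_base Φ.eq_zero_of_apply_last hd
    exact ⟨β, (Φ.isBase_iff β).2 ⟨hβ, fun h => absurd hd (by omega)⟩⟩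
  · exact ⟨1, (Φ.isBase_iff 1).2 ⟨fun k hk => absurd hk (by omega), fun _ => one_ne_zero⟩⟩

theorem IsBase.star {Φ : TridiagonalSystem F V d} {β : F} (h : Φ.IsBase β) : Φ.star.IsBase β :=
  ⟨fun k hk => (h.1 k hk).symm, h.2⟩

theorem IsBase.ddown {Φ : TridiagonalSystem F V d} {β : F} (h : Φ.IsBase β) :
    Φ.ddown.IsBase β := by
  rw [isBase_iff] at h ⊢
  refine ⟨fun k hk => ⟨?_, ?_⟩, h.2⟩
  · rw [ddown_eigenvalue, extendZero_rev _ (by omega), extendZero_rev _ (by omega),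
      extendZero_rev _ (by omega), extendZero_rev _ (by omega)]
    obtain ⟨m, rfl⟩ := Nat.exists_eq_add_of_le hk
    rw [show k + 3 + m - k = m + 3 by omega, show k + 3 + m - (k + 3) = m by omega,
      show k + 3 + m - (k + 1) = m + 2 by omega, show k + 3 + m - (k + 2) = m + 1 by omega]
    linear_combination -(h.1 m (by omega)).1
  · rw [ddown_dualEigenvalue]
    exact (h.1 k hk).2

end TridiagonalSystem

namespace TridiagonalSystem

open Finset

variable {F V : Type*} [Field F] [AddCommGroup V] [Module F V] {d : ℕ}

theorem splitSpace_zero (Φ : TridiagonalSystem F V d) :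
    Φ.splitSpace 0 = LinearMap.range (Φ.Estar 0) := by
  have hdual : ⨆ j : Set.Iic (0 : Fin (d + 1)), LinearMap.range (Φ.Estar j) =
      LinearMap.range (Φ.Estar 0) := by
    simp only [iSup_subtype, Set.mem_Iic, Fin.le_zero_iff, iSup_iSup_eq_left]
  have htop : ⨆ j : Set.Ici (0 : Fin (d + 1)), LinearMap.range (Φ.E j) = ⊤ := by
    refine top_le_iff.1 fun v _ => ?_
    rw [← LinearMap.id_apply (R := F) v, ← Module.End.one_eq_id,
      ← Φ.standard.sum_eq_one Φ.pair.diag, LinearMap.sum_apply]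
    exact sum_mem fun i _ => Submodule.mem_iSup_of_mem ⟨i, Fin.zero_le i⟩
      (LinearMap.mem_range_self _ v)
  rw [splitSpace, hdual, htop, inf_top_eq]

theorem splitMap_eq (Φ : TridiagonalSystem F V d) (i : Fin (d + 1)) :
    Φ.splitMap i =
      aeval Φ.Astar
          (Lagrange.nodal (range i) fun j => extendZero Φ.dualEigenvalue (j + 1)) *
        aeval Φ.A (Lagrange.nodal (range i) (extendZero Φ.eigenvalue)) := by
  rw [splitMap, Lagrange.nodal, Lagrange.nodal,
    ← prod_Ioc_zero_fin (fun k => X - C (extendZero Φ.dualEigenvalue k)),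
    ← prod_Iio_fin (fun k => X - C (extendZero Φ.eigenvalue k))]
  simp only [extendZero_val]

theorem isSplitSequence_iff (Φ : TridiagonalSystem F V d) (ζ : Fin (d + 1) → F) :
    Φ.IsSplitSequence ζ ↔ ∀ i, Φ.splitMap i * Φ.Estar 0 = ζ i • Φ.Estar 0 := by
  refine forall_congr' fun i => ?_
  rw [splitSpace_zero]
  constructor
  · exact fun h => LinearMap.ext fun v => h _ (LinearMap.mem_range_self _ v)
  · rintro h _ ⟨v, rfl⟩
    exact LinearMap.congr_fun h v

theorem splitMap_mul (Φ : TridiagonalSystem F V d) (i : Fin (d + 1)) :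
    Φ.splitMap i * Φ.Estar 0 =
      (∏ j ∈ range i,
        (extendZero Φ.dualEigenvalue 0 - extendZero Φ.dualEigenvalue (j + 1))) •
      (Φ.Estar 0 * aeval Φ.A (Lagrange.nodal (range i) (extendZero Φ.eigenvalue)) *
        Φ.Estar 0) := by
  rw [splitMap_eq, ← extendZero_zero Φ.Estar]
  exact Φ.star.isIdempotentSystem.aeval_nodal_succ_mul_aeval_nodal_mul (extendZero Φ.eigenvalue) i

theorem IsSharp.existsUnique_isSplitSequence {Φ : TridiagonalSystem F V d} (h : Φ.IsSharp) :
    ∃! ζ : Fin (d + 1) → F, Φ.IsSplitSequence ζ := by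
  have hex : ∀ i, ∃ c : F, Φ.splitMap i * Φ.Estar 0 = c • Φ.Estar 0 := fun i => by
    obtain ⟨c, hc⟩ := exists_mul_mul_eq_smul h.star
      (aeval Φ.A (Lagrange.nodal (range i) (extendZero Φ.eigenvalue)))
    exact ⟨_, (Φ.splitMap_mul i).trans ((congrArg _ hc).trans (smul_smul _ c _))⟩
  choose ζ hζ using hex
  refine ⟨ζ, (Φ.isSplitSequence_iff ζ).2 hζ, fun ξ hξ => funext fun i => ?_⟩
  refine smul_left_injective F (Φ.standard_star.ne_zero 0) ?_
  exact ((Φ.isSplitSequence_iff ξ).1 hξ i).symm.trans (hζ i)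

theorem IsSharp.splitMap_mul_Estar {Φ : TridiagonalSystem F V d} (h : Φ.IsSharp)
    (i : Fin (d + 1)) : Φ.splitMap i * Φ.Estar 0 = Φ.splitSeq i • Φ.Estar 0 :=
  (Φ.isSplitSequence_iff _).1 (Classical.epsilon_spec h.existsUnique_isSplitSequence.exists) i

theorem IsSharp.splitSeq_star {Φ : TridiagonalSystem F V d} (h : Φ.IsSharp) :
    Φ.star.splitSeq = Φ.splitSeq := by
  funext i
  have hζ := h.splitMap_mul_Estar i
  have hζstar := h.star.splitMap_mul_Estar i
  rw [splitMap_eq, ← extendZero_zero Φ.Estar] at hζ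
  rw [splitMap_eq, ← extendZero_zero Φ.star.Estar] at hζstar
  exact (Φ.isIdempotentPair.split_eigenvalue_eq hζ hζstar).symm

theorem IsSharp.splitSeq_eq {Φ : TridiagonalSystem F V d} (h : Φ.IsSharp) {m : ℕ → F}
    (hm : ∀ j ≤ d, Φ.Estar 0 * extendZero Φ.E j * Φ.Estar 0 = m j • Φ.Estar 0)
    (i : Fin (d + 1)) :
    Φ.splitSeq i =
      (∏ j ∈ range i,
        (extendZero Φ.dualEigenvalue 0 - extendZero Φ.dualEigenvalue (j + 1))) *
      ∑ j ∈ range (d + 1), m j *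
        ∏ k ∈ range i, (extendZero Φ.eigenvalue j - extendZero Φ.eigenvalue k) := by
  refine smul_left_injective F (Φ.standard_star.ne_zero 0) ?_
  change Φ.splitSeq i • Φ.Estar 0 = _ • Φ.Estar 0
  rw [← h.splitMap_mul_Estar, splitMap_mul, mul_smul, Φ.isIdempotentSystem.aeval_eq_sum,
    mul_sum, sum_mul, sum_smul]
  congr 1
  refine sum_congr rfl fun j hj => ?_
  rw [mul_smul_comm, smul_mul_assoc, hm j (mem_range_succ_iff.1 hj), smul_smul, mul_comm,
    Lagrange.eval_nodal]

theorem drinfeldPoly_of_ne (Φ : TridiagonalSystem F V d) {β : F}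
    (h : tridiagonalType d β ≠ .IIIplus) : Φ.drinfeldPoly β =
      ∑ i : Fin (d + 1), C (Φ.splitSeq i) * ∏ j ∈ Ioi i, Φ.drinfeldFactor β j := by
  unfold drinfeldPoly
  split
  · contradiction
  · rfl

theorem drinfeldPoly_of_eq (Φ : TridiagonalSystem F V d) {β : F}
    (h : tridiagonalType d β = .IIIplus) : Φ.drinfeldPoly β =
      ∏ i ∈ Ioi (0 : Fin (d + 1)), Φ.drinfeldFactorIIIplus i := by
  rw [drinfeldPoly, h]

theorem drinfeldFactor_star (Φ : TridiagonalSystem F V d) (β : F) :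
    Φ.star.drinfeldFactor β = Φ.drinfeldFactor β := by
  funext i
  rw [drinfeldFactor, drinfeldFactor, star_eigenvalue, star_dualEigenvalue,
    mul_comm (Φ.dualEigenvalue 0), mul_comm (Φ.dualEigenvalue (Fin.last d)),
    add_comm (_ * _) (_ * _), mul_comm (Φ.dualEigenvalue 0 - _)]

theorem drinfeldFactorIIIplus_star (Φ : TridiagonalSystem F V d) :
    Φ.star.drinfeldFactorIIIplus = Φ.drinfeldFactorIIIplus := by
  funext i
  rw [drinfeldFactorIIIplus, drinfeldFactorIIIplus, star_eigenvalue, star_dualEigenvalue,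
    mul_comm (Φ.dualEigenvalue 0), mul_comm (Φ.dualEigenvalue (Fin.last d)),
    add_comm (_ * _) (_ * _), mul_comm (Φ.dualEigenvalue 0 - _)]

theorem IsSharp.drinfeldPoly_star {Φ : TridiagonalSystem F V d} (h : Φ.IsSharp) (β : F) :
    Φ.star.drinfeldPoly β = Φ.drinfeldPoly β := by
  by_cases ht : tridiagonalType d β = .IIIplus
  · rw [drinfeldPoly_of_eq _ ht, drinfeldPoly_of_eq _ ht, drinfeldFactorIIIplus_star]
  · rw [drinfeldPoly_of_ne _ ht, drinfeldPoly_of_ne _ ht, drinfeldFactor_star, h.splitSeq_star]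

end TridiagonalSystem

theorem prod_range_two_mul {M : Type*} [CommMonoid M] (g : ℕ → M) (m : ℕ) :
    ∏ k ∈ Finset.range (2 * m), g k = ∏ j ∈ Finset.range m, (g (2 * j) * g (2 * j + 1)) := by
  induction m with
  | zero => simp
  | succ m ih =>
    rw [show 2 * (m + 1) = 2 * m + 1 + 1 by ring, Finset.prod_range_succ, Finset.prod_range_succ,
      ih, Finset.prod_range_succ, mul_assoc]

namespace TridiagonalSystem

open Finset

variable {F V : Type*} [Field F] [AddCommGroup V] [Module F V] {d : ℕ}

theorem IsBase.extendZero_eigenvalue {Φ : TridiagonalSystem F V d} {β : F} (hβ : Φ.IsBase β)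
    {k : ℕ} (hk : k ≤ d) : extendZero Φ.eigenvalue k =
      betaRecurrent β (extendZero Φ.eigenvalue 0) (extendZero Φ.eigenvalue 1)
        (extendZero Φ.eigenvalue 2) k :=
  eq_betaRecurrent (fun k hk => (((Φ.isBase_iff β).1 hβ).1 k hk).1) k hk

theorem IsBase.injOn_betaRecurrent {Φ : TridiagonalSystem F V d} {β : F} (hβ : Φ.IsBase β) :
    Set.InjOn (betaRecurrent β (extendZero Φ.eigenvalue 0) (extendZero Φ.eigenvalue 1)
      (extendZero Φ.eigenvalue 2)) (Set.Iic d) :=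
  Φ.isIdempotentSystem.injOn.congr fun _ hk => hβ.extendZero_eigenvalue hk

theorem IsBase.C_extendZero_eigenvalue {Φ : TridiagonalSystem F V d} {β : F}
    (hβ : Φ.IsBase β) {k : ℕ} (hk : k ≤ d) : C (extendZero Φ.eigenvalue k) =
      betaRecurrent (C β : F[X]) (C (extendZero Φ.eigenvalue 0)) (C (extendZero Φ.eigenvalue 1))
        (C (extendZero Φ.eigenvalue 2)) k :=
  (congrArg C (hβ.extendZero_eigenvalue hk)).trans (map_betaRecurrent C _ _ _ _ k)

theorem C_mul_drinfeldFactor (Φ : TridiagonalSystem F V d) {β s t : F} {i : Fin (d + 1)}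
    (hα : s * drinfeldAlpha d β i = t) :
    C s * Φ.drinfeldFactor β i =
      (C (Φ.eigenvalue 0) * C (Φ.dualEigenvalue (Fin.last d)) +
          C (Φ.eigenvalue (Fin.last d)) * C (Φ.dualEigenvalue 0) - X) * C t +
        C s * ((C (Φ.eigenvalue 0) - C (Φ.eigenvalue i)) *
          (C (Φ.dualEigenvalue 0) - C (Φ.dualEigenvalue i))) := by
  rw [← hα, drinfeldFactor]
  simp only [map_sub, map_mul, map_add]
  ring

theorem C_pow_mul_prod_drinfeldFactor (Φ : TridiagonalSystem F V d) {β : F} {S : ℕ → F}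
    (hα : ∀ i, S d * drinfeldAlpha d β i = S i) (i : Fin (d + 1)) :
    C (S d) ^ (d - i) * ∏ j ∈ Ioi i, Φ.drinfeldFactor β j =
      ∏ k ∈ Ico (i : ℕ) d,
        ((C (extendZero Φ.eigenvalue 0) * C (extendZero Φ.dualEigenvalue d) +
            C (extendZero Φ.eigenvalue d) * C (extendZero Φ.dualEigenvalue 0) - X) *
            C (S (k + 1)) +
          C (S d) * ((C (extendZero Φ.eigenvalue 0) - C (extendZero Φ.eigenvalue (k + 1))) *
            (C (extendZero Φ.dualEigenvalue 0) - C (extendZero Φ.dualEigenvalue (k + 1))))) := by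
  have hcard : (Ioi i).card = d - i := by rw [Fin.card_Ioi]; omega
  rw [← prod_Ioi_fin (fun k =>
    (C (extendZero Φ.eigenvalue 0) * C (extendZero Φ.dualEigenvalue d) +
      C (extendZero Φ.eigenvalue d) * C (extendZero Φ.dualEigenvalue 0) - X) * C (S k) +
    C (S d) * ((C (extendZero Φ.eigenvalue 0) - C (extendZero Φ.eigenvalue k)) *
      (C (extendZero Φ.dualEigenvalue 0) - C (extendZero Φ.dualEigenvalue k)))),
    ← hcard, ← prod_const, ← prod_mul_distrib]
  refine prod_congr rfl fun j _ => ?_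
  simp only [extendZero_zero, extendZero_last, extendZero_val]
  exact Φ.C_mul_drinfeldFactor (hα j)

theorem IsSharp.C_pow_mul_drinfeldPoly {Φ : TridiagonalSystem F V d} (h : Φ.IsSharp) {β : F}
    {S : ℕ → F} (hα : ∀ i, S d * drinfeldAlpha d β i = S i)
    (ht : tridiagonalType d β ≠ .IIIplus) {m : ℕ → F}
    (hm : ∀ j ≤ d, Φ.Estar 0 * extendZero Φ.E j * Φ.Estar 0 = m j • Φ.Estar 0) :
    C (S d) ^ d * Φ.drinfeldPoly β =
      ∑ j ∈ range (d + 1), C (m j) *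
        drinfeldSum d (fun k => C (extendZero Φ.eigenvalue k))
          (fun k => C (extendZero Φ.dualEigenvalue k)) (fun k => C (S k)) X
          (C (extendZero Φ.eigenvalue j)) := by
  rw [drinfeldPoly_of_ne _ ht, mul_sum]
  simp only [drinfeldSum, mul_sum]
  rw [sum_comm, sum_range]
  refine sum_congr rfl fun i _ => ?_
  have hpow : (C (S d) : F[X]) ^ d = C (S d) ^ (i : ℕ) * C (S d) ^ (d - i) := by
    rw [← pow_add, Nat.add_sub_cancel' i.is_le]
  rw [← Φ.C_pow_mul_prod_drinfeldFactor hα, h.splitSeq_eq hm i, prod_mul_distrib, prod_const,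
    card_range, hpow]
  simp only [map_mul, map_sum, map_prod, map_sub, mul_sum, sum_mul]
  refine sum_congr rfl fun j _ => ?_
  ring

theorem IsBase.drinfeldSum_ddown {Φ : TridiagonalSystem F V d} {β : F} (hβ : Φ.IsBase β)
    {j : ℕ} (hj : j ≤ d) :
    drinfeldSum d (fun k => C (extendZero Φ.ddown.eigenvalue k))
        (fun k => C (extendZero Φ.ddown.dualEigenvalue k))
        (fun k => C (betaRecurrent β 0 1 (β + 2) k)) X (C (extendZero Φ.eigenvalue j)) =
      drinfeldSum d (fun k => C (extendZero Φ.eigenvalue k))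
        (fun k => C (extendZero Φ.dualEigenvalue k))
        (fun k => C (betaRecurrent β 0 1 (β + 2) k)) X (C (extendZero Φ.eigenvalue j)) := by
  have hθ := fun k (hk : k ≤ d) => hβ.C_extendZero_eigenvalue hk
  have hσ := fun k (hk : k ≤ d) => hβ.star.C_extendZero_eigenvalue hk
  have hS : ∀ k ≤ d, C (betaRecurrent β 0 1 (β + 2) k) =
      betaRecurrent (C β : F[X]) 0 1 (C β + 2) k := fun k _ => by
    rw [map_betaRecurrent, map_zero, map_one, map_add, map_ofNat]
  have hθrev : ∀ k ≤ d, C (extendZero Φ.ddown.eigenvalue k) =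
      betaRecurrent (C β : F[X]) (C (extendZero Φ.eigenvalue 0)) (C (extendZero Φ.eigenvalue 1))
        (C (extendZero Φ.eigenvalue 2)) (d - k) := fun k hk => by
    rw [ddown_eigenvalue, extendZero_rev _ hk, hθ _ (Nat.sub_le d k)]
  rw [star_eigenvalue] at hσ
  rw [ddown_dualEigenvalue, drinfeldSum_congr hθ hσ hS, drinfeldSum_congr hθrev hσ hS, hθ j hj]
  exact drinfeldSum_betaRecurrent_reverse _ _ _ _ _ _ _ _ hj

theorem IsSharp.drinfeldPoly_ddown_of_ne {Φ : TridiagonalSystem F V d} (h : Φ.IsSharp) {β : F}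
    (hβ : Φ.IsBase β) (hd : 0 < d) (ht : tridiagonalType d β ≠ .IIIplus) :
    Φ.ddown.drinfeldPoly β = Φ.drinfeldPoly β := by
  obtain ⟨hS, hα⟩ := drinfeldAlpha_eq_betaRecurrent_div hβ.injOn_betaRecurrent hd hβ.2 ht
  replace hα : ∀ i, betaRecurrent β 0 1 (β + 2) d * drinfeldAlpha d β i =
      betaRecurrent β 0 1 (β + 2) i := fun i => by rw [hα, mul_div_cancel₀ _ hS]
  choose m hm using fun j => exists_mul_mul_eq_smul h.star (extendZero Φ.E j)
  have hmrev : ∀ j ≤ d, Φ.ddown.Estar 0 * extendZero Φ.ddown.E j * Φ.ddown.Estar 0 =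
      m (d - j) • Φ.ddown.Estar 0 := fun j hj =>
    (congrArg (Φ.Estar 0 * · * Φ.Estar 0) (extendZero_rev Φ.E hj)).trans (hm (d - j))
  refine mul_left_cancel₀ (pow_ne_zero d (C_ne_zero.2 hS)) ?_
  rw [h.C_pow_mul_drinfeldPoly hα ht fun j _ => hm j,
    h.ddown.C_pow_mul_drinfeldPoly hα ht hmrev, ← sum_range_reflect]
  refine sum_congr rfl fun j hj => ?_
  have hjd : j ≤ d := mem_range_succ_iff.1 hj
  have hθ : extendZero Φ.ddown.eigenvalue (d - j) = extendZero Φ.eigenvalue j := by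
    rw [ddown_eigenvalue, extendZero_rev _ (Nat.sub_le d j), Nat.sub_sub_self hjd]
  rw [Nat.add_sub_cancel, Nat.sub_sub_self hjd, hθ, hβ.drinfeldSum_ddown hjd]

theorem IsBase.eigenvalue_zero_sub {Φ : TridiagonalSystem F V d} {β : F} (hβ : Φ.IsBase β)
    (hd : 0 < d) (ht : tridiagonalType d β = .IIIplus) {i : Fin (d + 1)} (hi : Even (i : ℕ)) :
    Φ.eigenvalue 0 - Φ.eigenvalue i =
      ((i : ℕ) : F) / d * (Φ.eigenvalue 0 - Φ.eigenvalue (Fin.last d)) := by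
  obtain ⟨rfl, h₂, heven⟩ := tridiagonalType_eq_IIIplus ht
  have hne := hβ.injOn_betaRecurrent.ne (Set.mem_Iic.2 hd.le) (Set.mem_Iic.2 le_rfl) hd.ne
  have hsub := (betaRecurrent_neg_two_sub heven h₂ hne).2 i hi
  rwa [← hβ.extendZero_eigenvalue hd.le, ← hβ.extendZero_eigenvalue i.is_le,
    ← hβ.extendZero_eigenvalue le_rfl, extendZero_zero, extendZero_val, extendZero_last] at hsub

theorem drinfeldFactorIIIplus_of_not_even (Φ : TridiagonalSystem F V d) {i : Fin (d + 1)}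
    (hi : ¬ Even (i : ℕ)) : Φ.drinfeldFactorIIIplus i =
      C (Φ.eigenvalue 0 * Φ.dualEigenvalue (Fin.last d) +
        Φ.eigenvalue (Fin.last d) * Φ.dualEigenvalue 0) - X :=
  if_neg hi

theorem IsBase.drinfeldFactorIIIplus_of_even {Φ : TridiagonalSystem F V d} {β : F}
    (hβ : Φ.IsBase β) (hd : 0 < d) (ht : tridiagonalType d β = .IIIplus) {i : Fin (d + 1)}
    (hi : Even (i : ℕ)) : Φ.drinfeldFactorIIIplus i =
      C (((i : ℕ) : F) ^ 2 / (d : F) ^ 2) *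
        (C (Φ.eigenvalue 0 * Φ.dualEigenvalue 0 +
          Φ.eigenvalue (Fin.last d) * Φ.dualEigenvalue (Fin.last d)) - X) := by
  have hdual := hβ.star.eigenvalue_zero_sub hd ht hi
  rw [star_eigenvalue] at hdual
  rw [drinfeldFactorIIIplus, if_pos hi, hβ.eigenvalue_zero_sub hd ht hi, hdual, ← div_pow]
  simp only [map_add, map_sub, map_mul, map_pow]
  ring

theorem IsBase.drinfeldPoly_of_IIIplus {n : ℕ} {Φ : TridiagonalSystem F V (2 * n)} {β : F}
    (hβ : Φ.IsBase β) (ht : tridiagonalType (2 * n) β = .IIIplus) :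
    Φ.drinfeldPoly β =
      (C (Φ.eigenvalue 0 * Φ.dualEigenvalue (Fin.last _) +
          Φ.eigenvalue (Fin.last _) * Φ.dualEigenvalue 0) - X) ^ n *
        (C (Φ.eigenvalue 0 * Φ.dualEigenvalue 0 +
          Φ.eigenvalue (Fin.last _) * Φ.dualEigenvalue (Fin.last _)) - X) ^ n *
        ∏ j ∈ range n, C (((2 * j + 1 + 1 : ℕ) : F) ^ 2 / ((2 * n : ℕ) : F) ^ 2) := by
  have hext : ∏ i ∈ Ioi (0 : Fin (2 * n + 1)), Φ.drinfeldFactorIIIplus i =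
      ∏ k ∈ range (2 * n), extendZero Φ.drinfeldFactorIIIplus (k + 1) := by
    rw [range_eq_Ico]
    exact (prod_congr rfl fun i _ => (extendZero_val _ i).symm).trans
      (prod_Ioi_fin (extendZero Φ.drinfeldFactorIIIplus) 0)
  have hpow : ∀ p : F[X], p ^ n = ∏ _j ∈ range n, p := fun p => by rw [prod_const, card_range]
  rw [drinfeldPoly_of_eq _ ht, hext, prod_range_two_mul, hpow, hpow, ← prod_mul_distrib,
    ← prod_mul_distrib]
  refine prod_congr rfl fun j hj => ?_
  rw [mem_range] at hj
  have hodd : ¬ Even (2 * j + 1) := Nat.not_even_bit1 j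
  have heven : Even (2 * j + 1 + 1) := ⟨j + 1, by ring⟩
  rw [extendZero_of_le _ (by omega), extendZero_of_le _ (by omega),
    drinfeldFactorIIIplus_of_not_even _ hodd, hβ.drinfeldFactorIIIplus_of_even (by omega) ht heven,
    mul_left_comm, mul_comm]

theorem ddown_eq_self (Φ : TridiagonalSystem F V 0) : Φ.ddown = Φ := by
  obtain ⟨A, E, Astar, Estar⟩ := Φ
  simp only [ddown, mk.injEq, true_and, and_true]
  exact funext fun i => congrArg E (Fin.ext (by rw [Fin.val_rev]; omega))

theorem IsSharp.drinfeldPoly_ddown {Φ : TridiagonalSystem F V d} (h : Φ.IsSharp) {β : F}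
    (hβ : Φ.IsBase β) : Φ.ddown.drinfeldPoly β = Φ.drinfeldPoly β := by
  by_cases ht : tridiagonalType d β = .IIIplus
  · obtain ⟨n, rfl⟩ := even_iff_exists_two_mul.1 (tridiagonalType_eq_IIIplus ht).2.2
    rw [hβ.drinfeldPoly_of_IIIplus ht, hβ.ddown.drinfeldPoly_of_IIIplus ht, ddown_eigenvalue,
      ddown_dualEigenvalue]
    simp only [Fin.rev_zero, Fin.rev_last]
    rw [mul_comm (_ ^ n) (_ ^ n), add_comm (_ * _),
      add_comm (Φ.eigenvalue (Fin.last _) * Φ.dualEigenvalue (Fin.last _))]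
  · rcases Nat.eq_zero_or_pos d with rfl | hd
    · rw [ddown_eq_self]
    · exact h.drinfeldPoly_ddown_of_ne hβ hd ht

theorem Relative.isSharp {Φ Ψ : TridiagonalSystem F V d} (hΨ : Φ.Relative Ψ) (h : Φ.IsSharp) :
    Ψ.IsSharp := by
  induction hΨ with
  | refl => exact h
  | star _ ih => exact ih.star
  | down _ ih => exact ih.star.ddown.star
  | ddown _ ih => exact ih.ddown

theorem Relative.isBase {Φ Ψ : TridiagonalSystem F V d} (hΨ : Φ.Relative Ψ) {β : F}
    (hβ : Φ.IsBase β) : Ψ.IsBase β := by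
  induction hΨ with
  | refl => exact hβ
  | star _ ih => exact ih.star
  | down _ ih => exact ih.star.ddown.star
  | ddown _ ih => exact ih.ddown

theorem Relative.drinfeldPoly_eq {Φ Ψ : TridiagonalSystem F V d} (hΨ : Φ.Relative Ψ)
    (h : Φ.IsSharp) {β : F} (hβ : Φ.IsBase β) : Ψ.drinfeldPoly β = Φ.drinfeldPoly β := by
  induction hΨ with
  | refl => rfl
  | star hΨ ih => rw [(hΨ.isSharp h).drinfeldPoly_star, ih]
  | ddown hΨ ih => rw [(hΨ.isSharp h).drinfeldPoly_ddown (hΨ.isBase hβ), ih]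
  | @down Ψ hΨ ih =>
    have hsharp := (hΨ.isSharp h).star
    have hdown : Ψ.down = Ψ.star.ddown.star := rfl
    rw [hdown, hsharp.ddown.drinfeldPoly_star, hsharp.drinfeldPoly_ddown (hΨ.isBase hβ).star,
      (hΨ.isSharp h).drinfeldPoly_star, ih]

end TridiagonalSystem

theorem exists_step_of_path {d : ℕ} {σ : Fin (d + 1) → Fin (d + 1)}
    (hinj : Function.Injective σ)
    (hpath : ∀ i : Fin d, (σ i.succ : ℕ) ≤ σ i.castSucc + 1 ∧ (σ i.castSucc : ℕ) ≤ σ i.succ + 1) :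
    ∃ ε : ℤ, (ε = 1 ∨ ε = -1) ∧
      ∀ (k : ℕ) (hk : k < d + 1), (σ ⟨k, hk⟩ : ℤ) = (σ 0 : ℕ) + ε * k := by
  have hstep (k : ℕ) (hk : k < d) : (σ ⟨k + 1, by omega⟩ : ℤ) = σ ⟨k, by omega⟩ + 1 ∨
      (σ ⟨k + 1, by omega⟩ : ℤ) = σ ⟨k, by omega⟩ - 1 := by
    have hle : (σ ⟨k + 1, _⟩ : ℕ) ≤ σ ⟨k, _⟩ + 1 ∧ (σ ⟨k, _⟩ : ℕ) ≤ σ ⟨k + 1, _⟩ + 1 :=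
      hpath ⟨k, hk⟩
    have hne : (σ ⟨k + 1, by omega⟩ : ℕ) ≠ σ ⟨k, by omega⟩ := fun heq =>
      absurd (congrArg Fin.val (hinj (Fin.ext heq))) (Nat.succ_ne_self k)
    omega
  have hback (k : ℕ) (hk : k + 2 < d + 1) :
      (σ ⟨k + 2, hk⟩ : ℤ) ≠ σ ⟨k, by omega⟩ := fun heq =>
    absurd (congrArg Fin.val (hinj (Fin.ext (Nat.cast_injective heq)))) (by simp)
  rcases Nat.eq_zero_or_pos d with rfl | hd
  · refine ⟨1, .inl rfl, fun k hk => ?_⟩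
    obtain rfl : k = 0 := by omega
    simp
  obtain ⟨ε, hε, hone⟩ : ∃ ε : ℤ, (ε = 1 ∨ ε = -1) ∧
      (σ ⟨1, by omega⟩ : ℤ) = (σ 0 : ℕ) + ε := by
    rcases hstep 0 hd with h | h
    · exact ⟨1, .inl rfl, h⟩
    · exact ⟨-1, .inr rfl, h⟩
  refine ⟨ε, hε, fun k => ?_⟩
  induction k using Nat.twoStepInduction with
  | zero => exact fun _ => by simp
  | one => exact fun _ => by simpa using hone
  | more k ih₀ ih₁ =>
    intro hk
    have h₀ := ih₀ (by omega)
    have h₁ := ih₁ (by omega)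
    have hne := hback k hk
    have hs : (σ ⟨k + 2, hk⟩ : ℤ) = σ ⟨k + 1, by omega⟩ + 1 ∨
        (σ ⟨k + 2, hk⟩ : ℤ) = σ ⟨k + 1, by omega⟩ - 1 := hstep (k + 1) (by omega)
    rcases hε with rfl | rfl <;> push_cast at h₁ ⊢ <;> omega

theorem eq_id_or_eq_rev_of_path {d : ℕ} {σ : Fin (d + 1) → Fin (d + 1)}
    (hinj : Function.Injective σ)
    (hpath : ∀ i : Fin d, (σ i.succ : ℕ) ≤ σ i.castSucc + 1 ∧ (σ i.castSucc : ℕ) ≤ σ i.succ + 1) :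
    σ = id ∨ σ = Fin.rev := by
  obtain ⟨ε, hε, hσ⟩ := exists_step_of_path hinj hpath
  have hlast := hσ d (Nat.lt_succ_self d)
  have hlt := (σ ⟨d, Nat.lt_succ_self d⟩).is_le
  have hzero := (σ 0).is_le
  refine hε.imp ?_ ?_ <;> rintro rfl <;> refine funext fun i => Fin.ext ?_
  · have hi : (σ i : ℤ) = _ := hσ i i.isLt
    rw [id_eq]
    omega
  · have hi : (σ i : ℤ) = _ := hσ i i.isLt
    rw [Fin.val_rev]
    omega

namespace TridiagonalSystem

variable {F V : Type*} [Field F] [AddCommGroup V] [Module F V] {d : ℕ}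

theorem diameter_eq {d' : ℕ} {Φ : TridiagonalSystem F V d} {Ψ : TridiagonalSystem F V d'}
    (hA : Ψ.A = Φ.A) : d' = d := by
  have hrange : Set.range (fun i => LinearMap.range (Ψ.E i)) =
      Set.range fun i => LinearMap.range (Φ.E i) := by
    ext W
    rw [Set.mem_range, Set.mem_range, ← Φ.standard.standard.1.2 W, ← hA,
      Ψ.standard.standard.1.2 W]
  have hcard := Nat.card_congr (((Equiv.ofInjective _ Ψ.standard.standard.1.1).trans
    (Equiv.setCongr hrange)).trans (Equiv.ofInjective _ Φ.standard.standard.1.1).symm)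
  simpa using hcard

theorem exists_E_eq {Φ Ψ : TridiagonalSystem F V d} (hA : Ψ.A = Φ.A) :
    ∃ σ : Fin (d + 1) → Fin (d + 1), Function.Injective σ ∧ ∀ i, Ψ.E i = Φ.E (σ i) := by
  have hex : ∀ i, ∃ j, LinearMap.range (Φ.E j) = LinearMap.range (Ψ.E i) := fun i =>
    (Φ.standard.standard.1.2 _).1 (hA ▸ (Ψ.standard.standard.1.2 _).2 ⟨i, rfl⟩)
  choose σ hσ using hex
  have hinj : Function.Injective σ := fun i j hij =>
    Ψ.standard.standard.1.1 ((hσ i).symm.trans (hij ▸ hσ j))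
  have hmem : ∀ k v, Ψ.E k v ∈ LinearMap.range (Φ.E (σ k)) := fun k v =>
    hσ k ▸ LinearMap.mem_range_self _ v
  refine ⟨σ, hinj, fun i => LinearMap.ext fun v => ?_⟩
  have hother : ∀ k ≠ i, Φ.E (σ i) (Ψ.E k v) = 0 := fun k hk =>
    Φ.standard.apply_of_ne _ _ (hinj.ne hk) _ (hmem k v)
  calc Ψ.E i v = Φ.E (σ i) (Ψ.E i v) := (Φ.standard.apply_self _ _ (hmem i v)).symm
    _ = ∑ k, Φ.E (σ i) (Ψ.E k v) :=
      (Finset.sum_eq_single_of_mem i (Finset.mem_univ i) fun k _ => hother k).symm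
    _ = Φ.E (σ i) v := by
      rw [← map_sum, ← LinearMap.sum_apply, Ψ.standard.sum_eq_one Ψ.pair.diag,
        Module.End.one_apply]

theorem E_succ_mul_mul_E_ne_zero (Φ : TridiagonalSystem F V d) (i : Fin d) :
    Φ.E i.succ * Φ.Astar * Φ.E i.castSucc ≠ 0 := by
  have hne := Φ.star.isIdempotentPair.dual_mul_pow_mul_dual_ne_zero Φ.star.eq_zero_of_apply_last
    (i := i) (n := 1) (Nat.succ_le_of_lt i.isLt)
  rw [pow_one, extendZero_of_le _ (Nat.succ_le_of_lt i.isLt), extendZero_of_le _ i.isLt.le] at hne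
  exact hne

theorem E_eq_or_eq_rev {Φ Ψ : TridiagonalSystem F V d} (hA : Ψ.A = Φ.A)
    (hB : Ψ.Astar = Φ.Astar) : Ψ.E = Φ.E ∨ Ψ.E = fun i => Φ.E (Fin.rev i) := by
  obtain ⟨σ, hinj, hσ⟩ := exists_E_eq hA
  have hpath : ∀ i : Fin d,
      (σ i.succ : ℕ) ≤ σ i.castSucc + 1 ∧ (σ i.castSucc : ℕ) ≤ σ i.succ + 1 := by
    intro i
    have hne := Ψ.E_succ_mul_mul_E_ne_zero i
    rw [hσ, hσ, hB] at hne
    have hnear := mt Φ.standard.mul_mul_eq_zero hne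
    omega
  rcases eq_id_or_eq_rev_of_path hinj hpath with rfl | rfl
  · exact .inl (funext hσ)
  · exact .inr (funext hσ)

theorem relative_of_pair_eq {Φ Ψ : TridiagonalSystem F V d} (hA : Ψ.A = Φ.A)
    (hB : Ψ.Astar = Φ.Astar) : Φ.Relative Ψ := by
  have hext : ∀ Ψ' : TridiagonalSystem F V d, Φ.Relative Ψ' → Ψ.A = Ψ'.A → Ψ.E = Ψ'.E →
      Ψ.Astar = Ψ'.Astar → Ψ.Estar = Ψ'.Estar → Φ.Relative Ψ := by
    rintro ⟨⟩ hrel rfl rfl rfl rfl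
    exact hrel
  have hEstar : Ψ.Estar = Φ.Estar ∨ Ψ.Estar = fun i => Φ.Estar (Fin.rev i) :=
    E_eq_or_eq_rev (Φ := Φ.star) (Ψ := Ψ.star) hB hA
  rcases E_eq_or_eq_rev hA hB with h | h <;> rcases hEstar with h' | h'
  · exact hext Φ .refl hA h hB h'
  · exact hext Φ.down (.down .refl) hA h hB h'
  · exact hext Φ.ddown (.ddown .refl) hA h hB h'
  · exact hext Φ.ddown.down (.down (.ddown .refl)) hA h hB h'

end TridiagonalSystem

theorem theorem8_general {F V : Type*} [Field F] [AddCommGroup V] [Module F V] {d : ℕ}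
    (Φ : TridiagonalSystem F V d) (hΦ : Φ.IsSharp) :
    (∃ β : F, Φ.IsBase β) ∧
    (∀ Ψ : TridiagonalSystem F V d, Φ.Relative Ψ →
      Ψ.IsSharp ∧ ∃! ζ : Fin (d + 1) → F, Ψ.IsSplitSequence ζ) ∧
    (∀ β : F, Φ.IsBase β →
      ∀ Ψ : TridiagonalSystem F V d, Φ.Relative Ψ →
        Ψ.IsBase β ∧ Ψ.drinfeldPoly β = Φ.drinfeldPoly β) ∧
    (∀ β : F, Φ.IsBase β →
      ∀ (d' : ℕ) (Ψ : TridiagonalSystem F V d'),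
        ((Ψ.A = Φ.A ∧ Ψ.Astar = Φ.Astar) ∨ (Ψ.A = Φ.Astar ∧ Ψ.Astar = Φ.A)) →
        d' = d ∧ Ψ.IsSharp ∧ Ψ.IsBase β ∧ Ψ.drinfeldPoly β = Φ.drinfeldPoly β) := by
  refine ⟨Φ.exists_isBase,
    fun Ψ hΨ => ⟨hΨ.isSharp hΦ, (hΨ.isSharp hΦ).existsUnique_isSplitSequence⟩,
    fun β hβ Ψ hΨ => ⟨hΨ.isBase hβ, hΨ.drinfeldPoly_eq hΦ hβ⟩, ?_⟩
  rintro β hβ d' Ψ (⟨hA, hB⟩ | ⟨hA, hB⟩)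
  · obtain rfl := TridiagonalSystem.diameter_eq hA
    have hΨ := TridiagonalSystem.relative_of_pair_eq hA hB
    exact ⟨rfl, hΨ.isSharp hΦ, hΨ.isBase hβ, hΨ.drinfeldPoly_eq hΦ hβ⟩
  · obtain rfl := TridiagonalSystem.diameter_eq (Φ := Φ.star) hA
    have hΨ := TridiagonalSystem.relative_of_pair_eq (Φ := Φ.star) hA hB
    exact ⟨rfl, hΨ.isSharp hΦ.star, hΨ.isBase hβ.star,
      (hΨ.drinfeldPoly_eq hΦ.star hβ.star).trans (hΦ.drinfeldPoly_star β)⟩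

/-- For a sharp tridiagonal system `Φ` the data defining the Drinfel'd polynomial are well
defined (first two parts), the Drinfel'd polynomial is `D₄`-invariant (third part), and it
depends only on the unordered associated pair `A, A*` and the base (fourth part). -/
theorem theorem8 {F V : Type*} [Field F] [AddCommGroup V] [Module F V] [FiniteDimensional F V]
    [Nontrivial V] {d : ℕ} (Φ : TridiagonalSystem F V d) (hΦ : Φ.IsSharp) :
    (∃ β : F, Φ.IsBase β) ∧
    (∀ Ψ : TridiagonalSystem F V d, Φ.Relative Ψ →
      Ψ.IsSharp ∧ ∃! ζ : Fin (d + 1) → F, Ψ.IsSplitSequence ζ) ∧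
    (∀ β : F, Φ.IsBase β →
      ∀ Ψ : TridiagonalSystem F V d, Φ.Relative Ψ →
        Ψ.IsBase β ∧ Ψ.drinfeldPoly β = Φ.drinfeldPoly β) ∧
    (∀ β : F, Φ.IsBase β →
      ∀ (d' : ℕ) (Ψ : TridiagonalSystem F V d'),
        ((Ψ.A = Φ.A ∧ Ψ.Astar = Φ.Astar) ∨ (Ψ.A = Φ.Astar ∧ Ψ.Astar = Φ.A)) →
        d' = d ∧ Ψ.IsSharp ∧ Ψ.IsBase β ∧ Ψ.drinfeldPoly β = Φ.drinfeldPoly β) :=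
  theorem8_general Φ hΦ
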